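/- Let $\mathcal W$ be a finite group of linear isometries of $\mathbb R^d$ that is a reflection group of type $A_n$ ($n\ge 1$), $B_n$ ($n\ge 1$) or $D_n$ ($n\ge 2$); that is, $\mathcal W$ is generated by the reflections in the hyperplanes orthogonal to the vectors $f(a)$, $a\in\Phi$, where $f$ is a linear isometric embedding of $\operatorname{span}\Phi$ into $\mathbb R^d$ and $\Phi$ is respectively $\{e_i-e_j: i\ne j\}\subset\mathbb R^{n+1}$, $\{\pm e_i\}\cup\{\pm e_i\pm e_j: i\neq j\}\subset\mathbb R^n$, or $\{\pm e_i\pm e_j: i\ne j\}\subset\mathbb R^n$. Let $\mathcal A$ be the arrangement of the mirrors of all reflections in $\mathcal W$, let $L(\mathcal A)$ be the set of all intersections of subcollections of $\mathcal A$ (including $\mathbb R^d$, the empty intersection), let $\mu:L(\mathcal A)\to\mathbb Z$ be given by $\mu(\mathbb R^d)=1$ and $\sum_{Z\in L(\mathcal A),\, Z\supseteq X}\mu(Z)=0$ for $X\neq\mathbb R^d$, and let $$\chi(t)=\sum_{X\in L(\mathcal A)}\mu(X)\,t^{\dim X}$$ be the characteristic polynomial of $\mathcal A$. A fundamental chamber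 $\mathcal C$ of $\mathcal W$ is the closure of a connected component of $\mathbb R^d\setminus\bigcup_{H\in\mathcal A}H$. The orthogonal projection $\pi_{\mathcal C}(x)$ of $x\in\mathbb R^d$ onto $\mathcal C$ is called $k$-dimensional if it lies in the relative interior of a $k$-dimensional face of $\mathcal C$, and the projection volume $\nu_k(\mathcal C)$ is the fraction of the unit sphere of $\mathbb R^d$, measured by surface volume, occupied by the points $x$ with $\pi_{\mathcal C}(x)$ $k$-dimensional. Then the projection volumes of any fundamental chamber are proportional to the absolute values of the coefficients of $\chi$: there is a constant $c>0$ such that, for every fundamental chamber $\mathcal C$ of $\mathcal W$ and every integer $k\ge 0$, $$\nu_k(\mathcal C)=c\,\bigl|[t^k]\chi(t)\bigr| .$$ Moreover, for every such $\mathcal C$ and $k$, $\nu_k(\mathcal C)$ equals the probability that $\pi_{\mathcal C}(X)$ is $k$-dimensional for a standard Gaussian vector $X$ in $\mathbb R^d$. -/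

import Mathlib

namespace ReflArr

open MeasureTheory Module

section Arrangements

variable {V : Type*} [NormedAddCommGroup V] [InnerProductSpace ℝ V]

/-- The intersection lattice of a collection of linear hyperplanes: all intersections of
subcollections, the empty intersection being the whole space. -/
def intersectionLattice (𝒜 : Set (Submodule ℝ V)) : Set (Submodule ℝ V) :=
  {X | ∃ S ⊆ 𝒜, X = sInf S}

open Classical in
/-- The Möbius function of the intersection lattice of a finite arrangement, ordered by reverse
inclusion: `μ(V) = 1`, and the sum of `μ(Z)` over all `Z ⊇ X` in the lattice is `0` for every
other element `X` of the lattice. -/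
noncomputable def moebius [FiniteDimensional ℝ V] (𝒜 : Set (Submodule ℝ V)) (X : Submodule ℝ V) : ℤ :=
  if X = ⊤ then 1
  else - ∑ᶠ Z : {Z : Submodule ℝ V // Z ∈ intersectionLattice 𝒜 ∧ X < Z}, moebius 𝒜 Z.1
termination_by finrank ℝ V - finrank ℝ X
decreasing_by
  have h1 := Submodule.finrank_lt_finrank_of_lt Z.2.2
  have h2 := Submodule.finrank_le Z.1
  omega

/-- The characteristic polynomial `χ(t) = ∑_X μ(X) t ^ dim X`, the sum being over the
intersection lattice of a finite arrangement. -/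
noncomputable def charPoly [FiniteDimensional ℝ V] (𝒜 : Set (Submodule ℝ V)) : Polynomial ℤ :=
  ∑ᶠ X : intersectionLattice 𝒜,
    Polynomial.C (moebius 𝒜 X.1) * Polynomial.X ^ finrank ℝ X.1

/-- The reflection arrangement of a group of linear isometries: the collection of the mirrors of
all reflections that belong to the group. -/
def reflectionArrangement (W : Subgroup (V ≃ₗᵢ[ℝ] V)) : Set (Submodule ℝ V) :=
  {H | ∃ a : V, a ≠ 0 ∧ H = (ℝ ∙ a)ᗮ ∧ (ℝ ∙ a)ᗮ.reflection ∈ W}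

/-- The complement of the union of the hyperplanes of an arrangement. -/
def arrangementCompl (𝒜 : Set (Submodule ℝ V)) : Set V :=
  {x | ∀ H ∈ 𝒜, x ∉ H}

/-- A fundamental chamber of `W` is the closure of one of the regions of its reflection
arrangement, that is, of a connected component of the complement of the mirrors. -/
def IsFundamentalChamber (W : Subgroup (V ≃ₗᵢ[ℝ] V)) (C : Set V) : Prop :=
  ∃ x ∈ arrangementCompl (reflectionArrangement W),
    C = closure (connectedComponentIn (arrangementCompl (reflectionArrangement W)) x)

end Arrangements

section Projections

variable {V : Type*} [NormedAddCommGroup V] [InnerProductSpace ℝ V]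

/-- `z` is a nearest point to `x` in `C`. For a nonempty closed convex set `C` this determines
`z` uniquely, as the orthogonal projection of `x` onto `C`. -/
def IsProjectionOnto (C : Set V) (x z : V) : Prop :=
  z ∈ C ∧ ∀ y ∈ C, dist x z ≤ dist x y

/-- `z` lies in the relative interior of a `k`-dimensional face of the polyhedral cone `C`. A face
is a nonempty set of the points of `C` at which some linear functional is maximal on `C` (the
functional `0` gives `C` itself); its dimension is that of its affine hull. -/
def InRelintOfFace (C : Set V) (k : ℕ) (z : V) : Prop :=
  ∃ F : Set V, F.Nonempty ∧ IsExposed ℝ C F ∧ finrank ℝ (vectorSpan ℝ F) = k ∧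
    z ∈ intrinsicInterior ℝ F

/-- The set of the points whose projection onto `C` is `k`-dimensional. -/
def projDimSet (C : Set V) (k : ℕ) : Set V :=
  {x | ∃ z, IsProjectionOnto C x z ∧ InRelintOfFace C k z}

/-- The projection volume `ν_k`: the fraction of the unit sphere, as measured by surface volume,
that is occupied by the points whose projection onto `C` is `k`-dimensional. -/
noncomputable def projVolume [MeasurableSpace V] [BorelSpace V] [FiniteDimensional ℝ V]
    (C : Set V) (k : ℕ) : ℝ :=
  (volume : Measure V).toSphere.real {u : Metric.sphere (0 : V) 1 | (u : V) ∈ projDimSet C k} /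
    (volume : Measure V).toSphere.real Set.univ

end Projections

section Types

/-- The roots of type `A_n`: the vectors `e_i - e_j`, `i ≠ j`, of `ℝ^(n+1)`. -/
def rootsA (n : ℕ) : Set (EuclideanSpace ℝ (Fin (n + 1))) :=
  {a | ∃ i j, i ≠ j ∧ a = EuclideanSpace.single i (1 : ℝ) - EuclideanSpace.single j (1 : ℝ)}

/-- The roots of type `D_n`: the vectors `±e_i ± e_j`, `i ≠ j`, of `ℝ^n`. -/
def rootsD (n : ℕ) : Set (EuclideanSpace ℝ (Fin n)) :=
  {a | ∃ i j, i ≠ j ∧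
    (a = EuclideanSpace.single i (1 : ℝ) - EuclideanSpace.single j (1 : ℝ) ∨
      a = EuclideanSpace.single i (1 : ℝ) + EuclideanSpace.single j (1 : ℝ) ∨
      a = -(EuclideanSpace.single i (1 : ℝ) + EuclideanSpace.single j (1 : ℝ)))}

/-- The roots of type `B_n`: the vectors `±e_i` and `±e_i ± e_j`, `i ≠ j`, of `ℝ^n`. -/
def rootsB (n : ℕ) : Set (EuclideanSpace ℝ (Fin n)) :=
  {a | ∃ i, a = EuclideanSpace.single i (1 : ℝ) ∨ a = -EuclideanSpace.single i (1 : ℝ)} ∪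
    rootsD n

variable {E V : Type*} [NormedAddCommGroup E] [InnerProductSpace ℝ E]
  [NormedAddCommGroup V] [InnerProductSpace ℝ V]

/-- `W` is the reflection group of an isometric copy in `V` of the root system `Φ`: it is
generated by the reflections in the hyperplanes orthogonal to the roots of the copy. The copy may
span a proper subspace of `V`, and scaling the roots does not change the group. -/
def IsReflectionGroupOf (Φ : Set E) (W : Subgroup (V ≃ₗᵢ[ℝ] V)) : Prop :=
  ∃ f : Submodule.span ℝ Φ →ₗᵢ[ℝ] V,
    W = Subgroup.closure
      (Set.range fun a : Φ => (ℝ ∙ f ⟨a.1, Submodule.subset_span a.2⟩)ᗮ.reflection)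

/-- `W` is a reflection group of type `A_n` (`n ≥ 1`), `B_n` (`n ≥ 1`) or `D_n` (`n ≥ 2`). -/
def IsTypeABD (n : ℕ) (W : Subgroup (V ≃ₗᵢ[ℝ] V)) : Prop :=
  (1 ≤ n ∧ IsReflectionGroupOf (rootsA n) W) ∨
  (1 ≤ n ∧ IsReflectionGroupOf (rootsB n) W) ∨
  (2 ≤ n ∧ IsReflectionGroupOf (rootsD n) W)

end Types

end ReflArr

/-! Fix one normal vector per mirror; a chamber is then a nonempty cell given by a choice of signs.
For almost every `x`, the number of chambers onto which `x` projects `k`-dimensionally does not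
depend on `x` and equals `(-1) ^ (d + k)` times the coefficient of `t ^ k` in `χ`
(`ae_sum_cellInd_eq`).

This is proved by deletion and restriction. If a hyperplane cuts a cone `C` into `C₊` and `C₋` with
common wall `C₀`, then for generic `x` the indicators of `k`-dimensional projection satisfy `C₊ + C₋
= C + C₀` (`projInd_cons_add_projInd_cons`). Summed over all sign choices, this is the recursion of
`delResPoly`, the sign absorbing the drop of dimension on the wall. Whitney's formula identifies
`delResPoly` with `charPoly` (`exists_normals`).

The group permutes the chambers transitively by isometries (`IsFundamentalChamber.exists_image_eq`).
Hence for a finite isometry-invariant measure not charging hyperplanes, integrating the count gives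
equal contributions from the `N` chambers (`card_mul_measureReal_projDimSet`). Surface measure and
the Gaussian measure both qualify, and `c = 1 / N` in both cases. -/

namespace ReflArr

open MeasureTheory Module Filter Topology
open scoped RealInnerProductSpace

/-! ### Polyhedral cones: faces and nearest-point projection. -/

section Cones

variable {V : Type*} [NormedAddCommGroup V] [InnerProductSpace ℝ V]

/-- The polyhedral cone cut out of the subspace `U` by the closed half-spaces `⟪v, y⟫ ≥ 0`. -/
def polyCone (U : Submodule ℝ V) (b : List V) : Set V :=
  {y | y ∈ U ∧ ∀ v ∈ b, 0 ≤ ⟪v, y⟫}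

/-- The set cut out of the subspace `U` by the open half-spaces `⟪v, y⟫ > 0`. -/
def openCone (U : Submodule ℝ V) (b : List V) : Set V :=
  {y | y ∈ U ∧ ∀ v ∈ b, 0 < ⟪v, y⟫}

/-- The span of the minimal face of `polyCone U b` that contains the point `z` of the cone. -/
def faceSpan (U : Submodule ℝ V) (b : List V) (z : V) : Submodule ℝ V where
  carrier := {y | y ∈ U ∧ ∀ v ∈ b, ⟪v, z⟫ = 0 → ⟪v, y⟫ = 0}
  add_mem' hx hy := ⟨U.add_mem hx.1 hy.1, fun v hv h => by
    rw [inner_add_right, hx.2 v hv h, hy.2 v hv h, add_zero]⟩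
  zero_mem' := ⟨U.zero_mem, fun v _ _ => inner_zero_right v⟩
  smul_mem' c x hx := ⟨U.smul_mem c hx.1, fun v hv h => by
    rw [real_inner_smul_right, hx.2 v hv h, mul_zero]⟩

lemma mem_faceSpan {U : Submodule ℝ V} {b : List V} {z y : V} :
    y ∈ faceSpan U b z ↔ y ∈ U ∧ ∀ v ∈ b, ⟪v, z⟫ = 0 → ⟪v, y⟫ = 0 := Iff.rfl

lemma mem_orthogonal_singleton {a y : V} : y ∈ (ℝ ∙ a)ᗮ ↔ ⟪a, y⟫ = 0 :=
  Submodule.mem_orthogonal_singleton_iff_inner_right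

lemma self_mem_faceSpan {U : Submodule ℝ V} {b : List V} {z : V} (hz : z ∈ U) :
    z ∈ faceSpan U b z := ⟨hz, fun _ _ h => h⟩

lemma zero_mem_polyCone (U : Submodule ℝ V) (b : List V) : (0 : V) ∈ polyCone U b :=
  ⟨U.zero_mem, fun v _ => by simp⟩

lemma convex_polyCone (U : Submodule ℝ V) (b : List V) : Convex ℝ (polyCone U b) := by
  intro x hx y hy s t hs ht _
  refine ⟨U.add_mem (U.smul_mem _ hx.1) (U.smul_mem _ hy.1), fun v hv => ?_⟩
  rw [inner_add_right, real_inner_smul_right, real_inner_smul_right]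
  exact add_nonneg (mul_nonneg hs (hx.2 v hv)) (mul_nonneg ht (hy.2 v hv))

lemma convex_openCone (U : Submodule ℝ V) (b : List V) : Convex ℝ (openCone U b) := by
  intro x hx y hy s t hs ht hst
  refine ⟨U.add_mem (U.smul_mem _ hx.1) (U.smul_mem _ hy.1), fun v hv => ?_⟩
  rw [inner_add_right, real_inner_smul_right, real_inner_smul_right]
  have h1 := hx.2 v hv
  have h2 := hy.2 v hv
  rcases hs.eq_or_lt with rfl | hs
  · obtain rfl : t = 1 := by linarith
    simpa using h2
  · have := mul_pos hs h1
    have := mul_nonneg ht h2.le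
    linarith

lemma openCone_subset_polyCone (U : Submodule ℝ V) (b : List V) : openCone U b ⊆ polyCone U b :=
  fun _ hx => ⟨hx.1, fun v hv => (hx.2 v hv).le⟩

lemma isClosed_polyCone [FiniteDimensional ℝ V] (U : Submodule ℝ V) (b : List V) :
    IsClosed (polyCone U b) := by
  have : polyCone U b = (U : Set V) ∩ ⋂ v ∈ {v | v ∈ b}, {y | 0 ≤ ⟪v, y⟫} := by
    ext y; simp [polyCone]
  rw [this]
  refine U.closed_of_finiteDimensional.inter (isClosed_biInter fun v _ => ?_)
  exact isClosed_le continuous_const (by fun_prop)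

/-- Constraints active at `z` stay zero along `y`, and the finitely many inactive ones stay positive
by continuity. -/
lemma eventually_add_smul_mem_polyCone {U : Submodule ℝ V} {b : List V} {z y : V}
    (hz : z ∈ polyCone U b) (hy : y ∈ faceSpan U b z) :
    ∀ᶠ t : ℝ in 𝓝 0, z + t • y ∈ polyCone U b := by
  have key : ∀ᶠ t : ℝ in 𝓝 0, ∀ v ∈ {v | v ∈ b}, 0 ≤ ⟪v, z + t • y⟫ := by
    refine (eventually_all_finite b.finite_toSet).2 fun v hv => ?_
    rcases (hz.2 v hv).eq_or_lt with h | h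
    · refine Eventually.of_forall fun t => ?_
      rw [inner_add_right, real_inner_smul_right, hy.2 v hv h.symm, ← h]
      simp
    · have hc : ContinuousAt (fun t : ℝ => ⟪v, z + t • y⟫) 0 := by fun_prop
      have := hc.eventually (lt_mem_nhds (a := 0) (by simpa using h))
      exact this.mono fun t ht => ht.le
  exact key.mono fun t ht => ⟨U.add_mem hz.1 (U.smul_mem _ hy.1), ht⟩

lemma exists_add_smul_mem_polyCone {U : Submodule ℝ V} {b : List V} {z y : V}
    (hz : z ∈ polyCone U b) (hy : y ∈ faceSpan U b z) :
    ∃ t : ℝ, 0 < t ∧ z + t • y ∈ polyCone U b ∧ z - t • y ∈ polyCone U b := by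
  have h1 := eventually_add_smul_mem_polyCone hz hy
  have h2 := eventually_add_smul_mem_polyCone hz ((faceSpan U b z).neg_mem hy)
  obtain ⟨t, ht, h⟩ := (((h1.and h2).filter_mono nhdsWithin_le_nhds).and
    (self_mem_nhdsWithin (s := Set.Ioi (0 : ℝ)))).exists
  exact ⟨t, h, ht.1, by simpa [sub_eq_add_neg] using ht.2⟩

lemma vectorSpan_eq_of_forall_exists {F : Set V} {S : Submodule ℝ V} {z : V} (hF : F ⊆ S)
    (hz : z ∈ F) (h : ∀ v ∈ S, ∃ t : ℝ, 0 < t ∧ z + t • v ∈ F) : vectorSpan ℝ F = S := by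
  apply le_antisymm
  · rw [vectorSpan_def, Submodule.span_le]
    rintro _ ⟨x, hx, y, hy, rfl⟩
    exact S.sub_mem (hF hx) (hF hy)
  · intro v hv
    obtain ⟨t, ht, hm⟩ := h v hv
    have := vsub_mem_vectorSpan ℝ hm hz
    rw [vsub_eq_sub, add_sub_cancel_left] at this
    simpa [smul_smul, inv_mul_cancel₀ ht.ne'] using (vectorSpan ℝ F).smul_mem t⁻¹ this

/-- A segment ending at a relative interior point can be prolonged beyond it inside `F`, since the
line through `y` and `z` stays in the affine span. -/
lemma exists_sub_smul_mem_of_mem_intrinsicInterior {F : Set V} {z y : V}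
    (hz : z ∈ intrinsicInterior ℝ F) (hy : y ∈ F) : ∃ t : ℝ, 0 < t ∧ z - t • (y - z) ∈ F := by
  obtain ⟨z', hz', rfl⟩ := mem_intrinsicInterior.1 hz
  let g : ℝ → affineSpan ℝ F := fun t =>
    ⟨AffineMap.lineMap (z' : V) y (-t), AffineMap.lineMap_mem _ z'.2 (subset_affineSpan ℝ F hy)⟩
  have hg : Continuous g := by
    refine Continuous.subtype_mk ?_ _
    simp only [AffineMap.lineMap_apply]
    fun_prop
  have hg0 : g 0 = z' := by
    apply Subtype.ext
    simp [g]
  have := hg.continuousAt.eventually (mem_interior_iff_mem_nhds.1 (hg0.symm ▸ hz'))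
  obtain ⟨t, ht, h⟩ := ((this.filter_mono nhdsWithin_le_nhds).and
    (self_mem_nhdsWithin (s := Set.Ioi (0 : ℝ)))).exists
  refine ⟨t, h, ?_⟩
  have h3 : AffineMap.lineMap (z' : V) y (-t) ∈ F := ht
  rw [AffineMap.lineMap_apply] at h3
  convert h3 using 1
  simp only [vsub_eq_sub, vadd_eq_add, neg_smul]
  abel

/-- A point `z` is relatively interior to exactly one face, the part of the cone in `faceSpan U b
z`. This replaces faces by the linear algebra of active constraints. -/
lemma inRelintOfFace_polyCone {U : Submodule ℝ V} {b : List V} {k : ℕ} {z : V} :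
    InRelintOfFace (polyCone U b) k z ↔ z ∈ polyCone U b ∧ finrank ℝ (faceSpan U b z) = k := by
  classical
  constructor
  · rintro ⟨F, hne, hexp, hk, hz⟩
    have hzF := intrinsicInterior_subset hz
    obtain ⟨l, hl⟩ := hexp hne
    have hzC : z ∈ polyCone U b := by rw [hl] at hzF; exact hzF.1
    have hmax : ∀ y ∈ polyCone U b, l y ≤ l z := by rw [hl] at hzF; exact hzF.2
    refine ⟨hzC, ?_⟩
    have hspan : vectorSpan ℝ F = faceSpan U b z := by
      refine vectorSpan_eq_of_forall_exists ?_ hzF ?_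
      · intro y hy
        have hyC : y ∈ polyCone U b := by rw [hl] at hy; exact hy.1
        -- A constraint vanishing at `z` is nonnegative at `y` and also at a point on the other side
        -- of `z`, so it vanishes at `y`.
        obtain ⟨t, ht, hm⟩ := exists_sub_smul_mem_of_mem_intrinsicInterior hz hy
        have hmC : z - t • (y - z) ∈ polyCone U b := by rw [hl] at hm; exact hm.1
        refine ⟨hyC.1, fun v hv h => ?_⟩
        have h1 := hmC.2 v hv
        rw [inner_sub_right, real_inner_smul_right, inner_sub_right, h] at h1
        have h2 := hyC.2 v hv
        nlinarith
      · intro v hv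
        obtain ⟨t, ht, h1, h2⟩ := exists_add_smul_mem_polyCone hzC hv
        -- Both `z + t • v` and `z - t • v` lie in the cone, so maximality at `z` forces `l v = 0`.
        have e1 := hmax _ h1
        have e2 := hmax _ h2
        rw [map_add] at e1
        rw [map_sub] at e2
        refine ⟨t, ht, ?_⟩
        rw [hl]
        refine ⟨h1, fun y hy => ?_⟩
        rw [map_add]
        have := hmax y hy
        linarith
    rw [← hspan, hk]
  · rintro ⟨hz, hk⟩
    let F : Set V := {y | y ∈ polyCone U b ∧ y ∈ faceSpan U b z}
    have hzF : z ∈ F := ⟨hz, self_mem_faceSpan hz.1⟩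
    have hFS : F ⊆ faceSpan U b z := fun y hy => hy.2
    refine ⟨F, ⟨z, hzF⟩, fun _ => ?_, ?_, ?_⟩
    -- Minus the sum of the active normals exposes `F`: on the cone the summands are nonnegative, so
    -- the sum vanishes only if each of them does.
    · let s := b.toFinset.filter (fun v => ⟪v, z⟫ = 0)
      have hs : ∀ y ∈ polyCone U b, ∀ v ∈ s, 0 ≤ ⟪v, y⟫ := fun y hy v hv =>
        hy.2 v (List.mem_toFinset.1 (Finset.mem_filter.1 hv).1)
      have hsz : ∑ v ∈ s, ⟪v, z⟫ = 0 :=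
        Finset.sum_eq_zero fun v hv => (Finset.mem_filter.1 hv).2
      refine ⟨-innerSL ℝ (∑ v ∈ s, v), ?_⟩
      ext y
      simp only [Set.mem_ofPred_eq, _root_.neg_apply, innerSL_apply_apply, sum_inner,
        neg_le_neg_iff]
      constructor
      · rintro ⟨hy, hyS⟩
        refine ⟨hy, fun w hw => ?_⟩
        rw [Finset.sum_eq_zero fun v hv => hyS.2 v (List.mem_toFinset.1 (Finset.mem_filter.1 hv).1)
          (Finset.mem_filter.1 hv).2]
        exact Finset.sum_nonneg (hs w hw)
      · rintro ⟨hy, hm⟩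
        have h0 := hm z hz
        rw [hsz] at h0
        have h1 := (Finset.sum_eq_zero_iff_of_nonneg (hs y hy)).1
          (le_antisymm h0 (Finset.sum_nonneg (hs y hy)))
        exact ⟨hy, hy.1, fun v hv h =>
          h1 v (Finset.mem_filter.2 ⟨List.mem_toFinset.2 hv, h⟩)⟩
    · rw [vectorSpan_eq_of_forall_exists hFS hzF, hk]
      intro v hv
      obtain ⟨t, ht, h1, -⟩ := exists_add_smul_mem_polyCone hz hv
      exact ⟨t, ht, h1, (faceSpan U b z).add_mem (self_mem_faceSpan hz.1)
        ((faceSpan U b z).smul_mem _ hv)⟩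
    · refine mem_intrinsicInterior.2 ⟨⟨z, subset_affineSpan ℝ F hzF⟩, ?_, rfl⟩
      have hO : IsOpen (⋂ v ∈ {v | v ∈ b}, {y : V | ⟪v, z⟫ ≠ 0 → 0 < ⟪v, y⟫}) := by
        refine b.finite_toSet.isOpen_biInter fun v _ => ?_
        by_cases h : ⟪v, z⟫ = 0
        · simp [h]
        · simp only [ne_eq, h, not_false_eq_true, forall_const]
          exact isOpen_lt continuous_const (by fun_prop)
      refine mem_interior.2 ⟨_, ?_, hO.preimage continuous_subtype_val, ?_⟩
      · rintro ⟨y, hy⟩ hyO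
        have hyS : y ∈ faceSpan U b z := by
          have : affineSpan ℝ F ≤ (faceSpan U b z).toAffineSubspace := affineSpan_le.2 hFS
          exact this hy
        simp only [Set.mem_preimage, Set.mem_iInter, Set.mem_ofPred_eq] at hyO
        refine ⟨⟨hyS.1, fun v hv => ?_⟩, hyS⟩
        by_cases h : ⟪v, z⟫ = 0
        · exact (hyS.2 v hv h).ge
        · exact (hyO v hv h).le
      · simp only [Set.mem_preimage, Set.mem_iInter, Set.mem_ofPred_eq]
        exact fun v hv h => lt_of_le_of_ne (hz.2 v hv) (Ne.symm h)

lemma isProjectionOnto_iff {C : Set V} (hC : Convex ℝ C) {x z : V} :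
    IsProjectionOnto C x z ↔ z ∈ C ∧ ∀ y ∈ C, ⟪x - z, y - z⟫ ≤ 0 := by
  refine and_congr_right fun hz => ?_
  rw [← norm_eq_iInf_iff_real_inner_le_zero hC hz]
  have : Nonempty C := ⟨⟨z, hz⟩⟩
  have hbdd : BddBelow (Set.range fun w : C => ‖x - w‖) :=
    ⟨0, by rintro _ ⟨w, rfl⟩; exact norm_nonneg _⟩
  simp only [dist_eq_norm]
  constructor
  · intro h
    exact le_antisymm (le_ciInf fun w => h w w.2) (ciInf_le hbdd ⟨z, hz⟩)
  · intro h y hy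
    rw [h]
    exact ciInf_le hbdd ⟨y, hy⟩

lemma exists_isProjectionOnto_polyCone [FiniteDimensional ℝ V] (U : Submodule ℝ V) (b : List V)
    (x : V) : ∃ z, IsProjectionOnto (polyCone U b) x z := by
  obtain ⟨z, hz, h⟩ := exists_norm_eq_iInf_of_complete_convex ⟨0, zero_mem_polyCone U b⟩
    (isClosed_polyCone U b).isComplete (convex_polyCone U b) x
  exact ⟨z, (isProjectionOnto_iff (convex_polyCone U b)).2
    ⟨hz, (norm_eq_iInf_iff_real_inner_le_zero (convex_polyCone U b) hz).1 h⟩⟩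

/-- The two variational inequalities add up to `‖z - z'‖ ^ 2 ≤ ⟪x - x', z - z'⟫`. This yields
uniqueness of the projection, and its continuity for measurability. -/
lemma IsProjectionOnto.dist_le {C : Set V} (hC : Convex ℝ C) {x x' z z' : V}
    (h : IsProjectionOnto C x z) (h' : IsProjectionOnto C x' z') : dist z z' ≤ dist x x' := by
  rw [isProjectionOnto_iff hC] at h h'
  have h1 := h.2 z' h'.1
  have h2 := h'.2 z h.1
  have h3 := real_inner_le_norm (x - x') (z - z')
  have h4 : ⟪x - x', z - z'⟫ = ‖z - z'‖ ^ 2 - ⟪x - z, z' - z⟫ - ⟪x' - z', z - z'⟫ := by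
    rw [← real_inner_self_eq_norm_sq]
    simp only [inner_sub_left, inner_sub_right, real_inner_comm]
    ring
  rw [dist_eq_norm, dist_eq_norm]
  rcases (norm_nonneg (z - z')).eq_or_lt with h5 | h5
  · rw [← h5]; positivity
  · nlinarith

lemma IsProjectionOnto.unique {C : Set V} (hC : Convex ℝ C) {x z z' : V}
    (h : IsProjectionOnto C x z) (h' : IsProjectionOnto C x z') : z = z' :=
  dist_le_zero.1 (by simpa using h.dist_le hC h')

lemma IsProjectionOnto.mono {E : Type*} [NormedAddCommGroup E] {C D : Set E} {x z : E}
    (h : IsProjectionOnto C x z) (hD : D ⊆ C)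
    (hz : z ∈ D) : IsProjectionOnto D x z :=
  ⟨hz, fun y hy => h.2 y (hD hy)⟩

lemma IsProjectionOnto.mem_projDimSet_iff {U : Submodule ℝ V} {b : List V} {k : ℕ} {x z : V}
    (h : IsProjectionOnto (polyCone U b) x z) :
    x ∈ projDimSet (polyCone U b) k ↔ finrank ℝ (faceSpan U b z) = k := by
  constructor
  · rintro ⟨z', h', hk⟩
    rw [h.unique (convex_polyCone U b) h']
    exact (inRelintOfFace_polyCone.1 hk).2
  · exact fun hk => ⟨z, h, inRelintOfFace_polyCone.2 ⟨h.1, hk⟩⟩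

end Cones

/-! ### Cutting a cone by a hyperplane, and the deletion-restriction count. -/

section Splitting

variable {V : Type*} [NormedAddCommGroup V] [InnerProductSpace ℝ V]

lemma polyCone_cons (U : Submodule ℝ V) (a : V) (b : List V) :
    polyCone U (a :: b) = {y | y ∈ polyCone U b ∧ 0 ≤ ⟪a, y⟫} := by
  ext y
  simp only [polyCone, List.mem_cons, forall_eq_or_imp, Set.mem_ofPred_eq]
  tauto

lemma openCone_cons (U : Submodule ℝ V) (a : V) (b : List V) :
    openCone U (a :: b) = {y | y ∈ openCone U b ∧ 0 < ⟪a, y⟫} := by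
  ext y
  simp only [openCone, List.mem_cons, forall_eq_or_imp, Set.mem_ofPred_eq]
  tauto

lemma polyCone_inf (U : Submodule ℝ V) (a : V) (b : List V) :
    polyCone (U ⊓ (ℝ ∙ a)ᗮ) b = {y | y ∈ polyCone U b ∧ ⟪a, y⟫ = 0} := by
  ext y
  simp only [polyCone, Submodule.mem_inf, mem_orthogonal_singleton, Set.mem_ofPred_eq]
  tauto

lemma openCone_inf (U : Submodule ℝ V) (a : V) (b : List V) :
    openCone (U ⊓ (ℝ ∙ a)ᗮ) b = {y | y ∈ openCone U b ∧ ⟪a, y⟫ = 0} := by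
  ext y
  simp only [openCone, Submodule.mem_inf, mem_orthogonal_singleton, Set.mem_ofPred_eq]
  tauto

lemma faceSpan_cons_of_ne {U : Submodule ℝ V} {a : V} {b : List V} {z : V} (h : ⟪a, z⟫ ≠ 0) :
    faceSpan U (a :: b) z = faceSpan U b z := by
  ext y
  simp [mem_faceSpan, h]

lemma faceSpan_cons_of_eq {U : Submodule ℝ V} {a : V} {b : List V} {z : V} (h : ⟪a, z⟫ = 0) :
    faceSpan U (a :: b) z = faceSpan (U ⊓ (ℝ ∙ a)ᗮ) b z := by
  ext y
  simp only [mem_faceSpan, List.mem_cons, forall_eq_or_imp, h, Submodule.mem_inf,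
    mem_orthogonal_singleton]
  tauto

lemma faceSpan_inf (U : Submodule ℝ V) (a : V) (b : List V) (z : V) :
    faceSpan (U ⊓ (ℝ ∙ a)ᗮ) b z = faceSpan U b z ⊓ (ℝ ∙ a)ᗮ := by
  ext y
  simp only [mem_faceSpan, Submodule.mem_inf]
  tauto

lemma orthogonal_singleton_neg (a : V) : (ℝ ∙ (-a))ᗮ = (ℝ ∙ a)ᗮ := by
  ext y
  simp [mem_orthogonal_singleton]

/-- Each constraint is either active, which shrinks `U`, or irrelevant. Finiteness makes the
exceptional set of non-generic points a finite union of hyperplanes. -/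
lemma finite_range_faceSpan (b : List V) :
    ∀ U : Submodule ℝ V, (Set.range (faceSpan U b)).Finite := by
  induction b with
  | nil =>
    intro U
    refine (Set.finite_singleton U).subset ?_
    rintro _ ⟨z, rfl⟩
    ext y
    simp [mem_faceSpan]
  | cons a b ih =>
    intro U
    refine ((ih U).union (ih (U ⊓ (ℝ ∙ a)ᗮ))).subset ?_
    rintro _ ⟨z, rfl⟩
    by_cases h : ⟪a, z⟫ = 0
    · exact Or.inr ⟨z, (faceSpan_cons_of_eq h).symm⟩
    · exact Or.inl ⟨z, (faceSpan_cons_of_ne h).symm⟩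

/-- If the projection of `x` onto a polyhedral cone lies strictly on the positive side of the
hyperplane orthogonal to `a`, then the projection onto the negative part of the cone lies on the
hyperplane. -/
lemma IsProjectionOnto.inner_eq_zero_of_pos {C : Set V} (hC : Convex ℝ C) {a x z p : V}
    (hz : IsProjectionOnto C x z) (hpos : 0 < ⟪a, z⟫)
    (hp : IsProjectionOnto {y | y ∈ C ∧ ⟪a, y⟫ ≤ 0} x p) : ⟪a, p⟫ = 0 := by
  by_contra hne
  have hneg : ⟪a, p⟫ < 0 := lt_of_le_of_ne hp.1.2 hne
  have hconv : Convex ℝ {y | y ∈ C ∧ ⟪a, y⟫ ≤ 0} :=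
    hC.inter (convex_halfSpace_le (innerSL ℝ a).toLinearMap.isLinear 0)
  have hd : 0 < ⟪a, z⟫ - ⟪a, p⟫ := by linarith
  -- `s • p + t • z` is the point where the segment from `p` to `z` crosses the hyperplane. It is no
  -- farther from `x` than `p`, because `z` is not, so it is a second projection onto the negative
  -- part.
  let s := ⟪a, z⟫ / (⟪a, z⟫ - ⟪a, p⟫)
  let t := -⟪a, p⟫ / (⟪a, z⟫ - ⟪a, p⟫)
  have hs : 0 ≤ s := div_nonneg hpos.le hd.le
  have ht : 0 ≤ t := div_nonneg (by linarith) hd.le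
  have hst : s + t = 1 := by simp only [s, t]; field_simp; ring
  have hq0 : ⟪a, s • p + t • z⟫ = 0 := by
    rw [inner_add_right, real_inner_smul_right, real_inner_smul_right]
    simp only [s, t]; field_simp; ring
  have hqC : s • p + t • z ∈ C := hC hp.1.1 hz.1 hs ht hst
  have hball := (convex_closedBall x (dist x p)) (x := p) (y := z)
    (by simp [dist_comm]) (by simpa [dist_comm] using hz.2 p hp.1.1) hs ht hst
  have hq : IsProjectionOnto {y | y ∈ C ∧ ⟪a, y⟫ ≤ 0} x (s • p + t • z) :=
    ⟨⟨hqC, hq0.le⟩, fun y hy => by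
      rw [Metric.mem_closedBall, dist_comm] at hball
      exact hball.trans (hp.2 y hy)⟩
  rw [hq.unique hconv hp] at hq0
  exact hne hq0

lemma finrank_inf_orthogonal_singleton [FiniteDimensional ℝ V] {U : Submodule ℝ V} {a : V}
    (h : ¬ U ≤ (ℝ ∙ a)ᗮ) :
    finrank ℝ ↥(U ⊓ (ℝ ∙ a)ᗮ) + 1 = finrank ℝ U := by
  let f : U →ₗ[ℝ] ℝ := (innerSL ℝ a).toLinearMap ∘ₗ U.subtype
  have hf : f ≠ 0 := by
    rintro h0
    exact h fun y hy => mem_orthogonal_singleton.2 (LinearMap.congr_fun h0 ⟨y, hy⟩)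
  have h1 := LinearMap.finrank_range_add_finrank_ker f
  rw [LinearMap.range_eq_top.2 (LinearMap.surjective hf), finrank_top, finrank_self] at h1
  have h2 : U ⊓ (ℝ ∙ a)ᗮ = (LinearMap.ker f).map U.subtype := by
    ext y
    simp only [Submodule.mem_inf, mem_orthogonal_singleton, Submodule.mem_map, LinearMap.mem_ker,
      Subtype.exists]
    constructor
    · rintro ⟨hy, h⟩
      exact ⟨y, hy, h, rfl⟩
    · rintro ⟨y, hy, h, rfl⟩
      exact ⟨hy, h⟩
  rw [h2, (Submodule.equivMapOfInjective U.subtype U.subtype_injective _).finrank_eq.symm]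
  omega

/-- The half containing `z` keeps `z` as projection, with the new constraint inactive; the other
half projects `x` onto the wall. So the terms of the valuation identity match in pairs. -/
lemma mem_projDimSet_of_inner_pos [FiniteDimensional ℝ V] {U : Submodule ℝ V}
    {a x z : V} {b : List V}
    (hz : IsProjectionOnto (polyCone U b) x z) (hpos : 0 < ⟪a, z⟫) (k : ℕ) :
    (x ∈ projDimSet (polyCone U (a :: b)) k ↔ x ∈ projDimSet (polyCone U b) k) ∧
    (x ∈ projDimSet (polyCone U (-a :: b)) k ↔ x ∈ projDimSet (polyCone (U ⊓ (ℝ ∙ a)ᗮ) b) k) := by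
  constructor
  · have h1 : IsProjectionOnto (polyCone U (a :: b)) x z := by
      rw [polyCone_cons]
      exact hz.mono (fun y hy => hy.1) ⟨hz.1, hpos.le⟩
    rw [h1.mem_projDimSet_iff, hz.mem_projDimSet_iff, faceSpan_cons_of_ne hpos.ne']
  · obtain ⟨p, hp⟩ := exists_isProjectionOnto_polyCone U (-a :: b) x
    have hset : polyCone U (-a :: b) = {y | y ∈ polyCone U b ∧ ⟪a, y⟫ ≤ 0} := by
      rw [polyCone_cons]; simp
    have hp0 : ⟪a, p⟫ = 0 :=
      hz.inner_eq_zero_of_pos (convex_polyCone U b) hpos (hset ▸ hp)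
    have h2 : IsProjectionOnto (polyCone (U ⊓ (ℝ ∙ a)ᗮ) b) x p := by
      refine hp.mono ?_ ?_
      · rw [polyCone_inf, hset]
        exact fun y hy => ⟨hy.1, hy.2.le⟩
      · rw [polyCone_inf]
        have := hp.1
        rw [hset] at this
        exact ⟨this.1, hp0⟩
    rw [hp.mem_projDimSet_iff, h2.mem_projDimSet_iff, faceSpan_cons_of_eq (by simpa using hp0),
      orthogonal_singleton_neg]

/-- The indicator function of `projDimSet (polyCone U b) k`. -/
noncomputable def projInd (U : Submodule ℝ V) (b : List V) (k : ℕ) : V → ℝ :=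
  (projDimSet (polyCone U b) k).indicator 1

lemma projInd_congr {U U' : Submodule ℝ V} {b b' : List V} {k : ℕ} {x : V}
    (h : x ∈ projDimSet (polyCone U b) k ↔ x ∈ projDimSet (polyCone U' b') k) :
    projInd U b k x = projInd U' b' k x := by
  classical
  simp only [projInd, Set.indicator_apply, h]

/-- Away from finitely many hyperplanes, the indicator of `k`-dimensional projection is a
valuation with respect to cutting a cone by a hyperplane. -/
lemma projInd_cons_add_projInd_cons [FiniteDimensional ℝ V] {U : Submodule ℝ V}
    {a x : V} {b : List V}
    (hx : ∀ S ∈ Set.range (faceSpan U b), S.starProjection a ≠ 0 → ⟪S.starProjection a, x⟫ ≠ 0)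
    (k : ℕ) :
    projInd U (a :: b) k x + projInd U (-a :: b) k x =
      projInd U b k x + projInd (U ⊓ (ℝ ∙ a)ᗮ) b k x := by
  obtain ⟨z, hz⟩ := exists_isProjectionOnto_polyCone U b x
  rcases lt_trichotomy ⟪a, z⟫ 0 with h | h | h
  · have := mem_projDimSet_of_inner_pos (a := -a) hz (by simpa using h) k
    rw [neg_neg, orthogonal_singleton_neg] at this
    rw [projInd_congr this.1, projInd_congr this.2, add_comm]
  -- Otherwise the projection `q` of `a` to `S` is nonzero. Moving from `z` along `±q` stays in the
  -- cone, so `x - z` is orthogonal to `q`; so is `z`, as `⟪q, z⟫ = ⟪a, z⟫ = 0`. Then `⟪q, x⟫ = 0`,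
  -- which genericity excludes.
  · have hle : faceSpan U b z ≤ (ℝ ∙ a)ᗮ := by
      by_contra hcon
      set S := faceSpan U b z
      have hne : S.starProjection a ≠ 0 := by
        intro h0
        refine hcon fun v hv => ?_
        rw [mem_orthogonal_singleton, ← Submodule.starProjection_eq_self_iff.2 hv,
          ← Submodule.inner_starProjection_left_eq_right, h0, inner_zero_left]
      refine hx S ⟨z, rfl⟩ hne ?_
      have hzS : ⟪S.starProjection a, z⟫ = 0 := by
        rw [Submodule.inner_starProjection_left_eq_right,
          Submodule.starProjection_eq_self_iff.2 (self_mem_faceSpan hz.1.1), h]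
      obtain ⟨t, ht, h1, h2⟩ := exists_add_smul_mem_polyCone hz.1
        (Submodule.starProjection_apply_mem S a)
      have hvar := ((isProjectionOnto_iff (convex_polyCone U b)).1 hz).2
      have e1 := hvar _ h1
      have e2 := hvar _ h2
      rw [add_sub_cancel_left, real_inner_smul_right] at e1
      rw [sub_sub_cancel_left, inner_neg_right, real_inner_smul_right] at e2
      have e3 : ⟪x - z, S.starProjection a⟫ = 0 := by
        have : t * ⟪x - z, S.starProjection a⟫ = 0 := by linarith
        exact (mul_eq_zero.1 this).resolve_left ht.ne'
      rw [inner_sub_left, real_inner_comm, real_inner_comm (S.starProjection a) z, hzS,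
        sub_zero] at e3
      exact e3
    have h1 : IsProjectionOnto (polyCone U (a :: b)) x z := by
      rw [polyCone_cons]
      exact hz.mono (fun y hy => hy.1) ⟨hz.1, h.ge⟩
    have h2 : IsProjectionOnto (polyCone U (-a :: b)) x z := by
      rw [polyCone_cons]
      exact hz.mono (fun y hy => hy.1) ⟨hz.1, by simp [h]⟩
    have h3 : IsProjectionOnto (polyCone (U ⊓ (ℝ ∙ a)ᗮ) b) x z := by
      rw [polyCone_inf]
      exact hz.mono (fun y hy => hy.1) ⟨hz.1, h⟩
    have hS : faceSpan U b z ⊓ (ℝ ∙ a)ᗮ = faceSpan U b z := inf_eq_left.2 hle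
    congr 1 <;> apply projInd_congr
    · rw [h1.mem_projDimSet_iff, hz.mem_projDimSet_iff, faceSpan_cons_of_eq h, faceSpan_inf, hS]
    · rw [h2.mem_projDimSet_iff, h3.mem_projDimSet_iff,
        faceSpan_cons_of_eq (by simpa using h), orthogonal_singleton_neg]
  · have := mem_projDimSet_of_inner_pos hz h k
    rw [projInd_congr this.1, projInd_congr this.2]

lemma closure_openCone [FiniteDimensional ℝ V] {U : Submodule ℝ V} {b : List V}
    (h : (openCone U b).Nonempty) :
    closure (openCone U b) = polyCone U b := by
  refine (closure_minimal (openCone_subset_polyCone U b) (isClosed_polyCone U b)).antisymm ?_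
  obtain ⟨w, hw⟩ := h
  intro y hy
  have hc : Tendsto (fun t : ℝ => y + t • w) (𝓝[>] 0) (𝓝 y) := by
    have : ContinuousAt (fun t : ℝ => y + t • w) 0 := by fun_prop
    simpa using this.tendsto.mono_left nhdsWithin_le_nhds
  refine mem_closure_of_tendsto hc (eventually_mem_nhdsWithin.mono fun t ht => ?_)
  refine ⟨U.add_mem hy.1 (U.smul_mem _ hw.1), fun v hv => ?_⟩
  rw [inner_add_right, real_inner_smul_right]
  exact add_pos_of_nonneg_of_pos (hy.2 v hv) (mul_pos ht (hw.2 v hv))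

lemma exists_add_smul_mem_openCone {U : Submodule ℝ V} {b : List V} {y w : V}
    (hy : y ∈ openCone U b) (hw : w ∈ U) :
    ∃ t : ℝ, 0 < t ∧ y + t • w ∈ openCone U b ∧ y - t • w ∈ openCone U b := by
  have key : ∀ w ∈ U, ∀ᶠ t : ℝ in 𝓝[>] 0, y + t • w ∈ openCone U b := by
    intro w hw
    have : ∀ᶠ t : ℝ in 𝓝 0, ∀ v ∈ {v | v ∈ b}, 0 < ⟪v, y + t • w⟫ := by
      refine (eventually_all_finite b.finite_toSet).2 fun v hv => ?_
      have hc : ContinuousAt (fun t : ℝ => ⟪v, y + t • w⟫) 0 := by fun_prop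
      exact hc.eventually (lt_mem_nhds (a := 0) (by simpa using hy.2 v hv))
    exact (this.filter_mono nhdsWithin_le_nhds).mono fun t ht =>
      ⟨U.add_mem hy.1 (U.smul_mem _ hw), ht⟩
  obtain ⟨t, ⟨h1, h2⟩, h3⟩ := ((key w hw).and (key (-w) (U.neg_mem hw))).and
    self_mem_nhdsWithin |>.exists
  exact ⟨t, h3, h1, by simpa [sub_eq_add_neg] using h2⟩

lemma openCone_cons_nonempty_of_inf {U : Submodule ℝ V} {a : V} {b : List V}
    (ha : ¬ U ≤ (ℝ ∙ a)ᗮ) (h : (openCone (U ⊓ (ℝ ∙ a)ᗮ) b).Nonempty) :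
    (openCone U (a :: b)).Nonempty ∧ (openCone U (-a :: b)).Nonempty := by
  obtain ⟨y, hy⟩ := h
  rw [openCone_inf] at hy
  obtain ⟨w, hw, hne⟩ := SetLike.not_le_iff_exists.1 ha
  rw [mem_orthogonal_singleton] at hne
  wlog hpos : 0 < ⟪a, w⟫ generalizing w
  · refine this (-w) (U.neg_mem hw) (by simpa using hne) ?_
    rw [inner_neg_right]
    have := lt_of_le_of_ne (not_lt.1 hpos) hne
    linarith
  obtain ⟨t, ht, h1, h2⟩ := exists_add_smul_mem_openCone hy.1 hw
  have := mul_pos ht hpos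
  constructor
  · rw [openCone_cons]
    refine ⟨_, h1, ?_⟩
    rw [inner_add_right, hy.2, real_inner_smul_right, zero_add]
    exact this
  · rw [openCone_cons]
    refine ⟨_, h2, ?_⟩
    rw [inner_neg_left, inner_sub_right, hy.2, real_inner_smul_right]
    linarith

lemma openCone_inf_nonempty {U : Submodule ℝ V} {a : V} {b : List V}
    (h1 : (openCone U (a :: b)).Nonempty) (h2 : (openCone U (-a :: b)).Nonempty) :
    (openCone (U ⊓ (ℝ ∙ a)ᗮ) b).Nonempty := by
  obtain ⟨y, hy⟩ := h1
  obtain ⟨w, hw⟩ := h2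
  rw [openCone_cons] at hy hw
  have hw2 := hw.2
  rw [inner_neg_left] at hw2
  have hd : 0 < ⟪a, y⟫ - ⟪a, w⟫ := by linarith [hy.2]
  -- The weights are those for which the segment from `y` to `w` meets the hyperplane.
  refine ⟨(-⟪a, w⟫ / (⟪a, y⟫ - ⟪a, w⟫)) • y + (⟪a, y⟫ / (⟪a, y⟫ - ⟪a, w⟫)) • w, ?_⟩
  rw [openCone_inf]
  refine ⟨convex_openCone U b hy.1 hw.1 (div_nonneg hw2.le hd.le) (div_nonneg hy.2.le hd.le) ?_, ?_⟩
  · field_simp; ring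
  · rw [inner_add_right, real_inner_smul_right, real_inner_smul_right]
    field_simp; ring

open Classical in
/-- The indicator function of `projDimSet (polyCone U b) k`, replaced by zero when the
open cone is empty. -/
noncomputable def cellInd (U : Submodule ℝ V) (b : List V) (k : ℕ) (x : V) : ℝ :=
  if (openCone U b).Nonempty then projInd U b k x else 0

lemma cellInd_cons_add_cellInd_cons_of_le {U : Submodule ℝ V} {a : V} (ha : U ≤ (ℝ ∙ a)ᗮ)
    (b : List V) (k : ℕ) (x : V) : cellInd U (a :: b) k x + cellInd U (-a :: b) k x = 0 := by
  have key : ∀ y ∈ U, ⟪a, y⟫ = 0 := fun y hy => mem_orthogonal_singleton.1 (ha hy)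
  have h1 : ¬ (openCone U (a :: b)).Nonempty := by
    rintro ⟨y, hy⟩
    exact (hy.2 a (by simp)).ne' (key y hy.1)
  have h2 : ¬ (openCone U (-a :: b)).Nonempty := by
    rintro ⟨y, hy⟩
    exact (hy.2 (-a) (by simp)).ne' (by simp [key y hy.1])
  simp [cellInd, h1, h2]

/-- If the hyperplane meets the open cone, both halves are nonempty and the valuation identity
applies. If it misses the cone, a nonempty open cone lies entirely on one side; that half has the
same closure, and the other half and the wall count as zero. -/
lemma cellInd_cons_add_cellInd_cons [FiniteDimensional ℝ V] {U : Submodule ℝ V}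
    {a x : V} {b : List V}
    (ha : ¬ U ≤ (ℝ ∙ a)ᗮ)
    (hx : ∀ S ∈ Set.range (faceSpan U b), S.starProjection a ≠ 0 → ⟪S.starProjection a, x⟫ ≠ 0)
    (k : ℕ) :
    cellInd U (a :: b) k x + cellInd U (-a :: b) k x =
      cellInd U b k x + cellInd (U ⊓ (ℝ ∙ a)ᗮ) b k x := by
  have sub1 : openCone U (a :: b) ⊆ openCone U b := by
    rw [openCone_cons]; exact fun y hy => hy.1
  have sub2 : openCone U (-a :: b) ⊆ openCone U b := by
    rw [openCone_cons]; exact fun y hy => hy.1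
  have hcov : ∀ y ∈ openCone U b, y ∈ openCone U (a :: b) ∨ y ∈ openCone U (-a :: b) ∨
      y ∈ openCone (U ⊓ (ℝ ∙ a)ᗮ) b := by
    intro y hy
    rw [openCone_cons, openCone_cons, openCone_inf]
    rcases lt_trichotomy ⟪a, y⟫ 0 with h | h | h
    · exact Or.inr (Or.inl ⟨hy, by simpa using h⟩)
    · exact Or.inr (Or.inr ⟨hy, h⟩)
    · exact Or.inl ⟨hy, h⟩
  by_cases h0 : (openCone (U ⊓ (ℝ ∙ a)ᗮ) b).Nonempty
  · obtain ⟨h1, h2⟩ := openCone_cons_nonempty_of_inf ha h0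
    simp only [cellInd, h0, h1, h2, h1.mono sub1, if_true]
    exact projInd_cons_add_projInd_cons hx k
  have hcov' : ∀ y ∈ openCone U b, y ∈ openCone U (a :: b) ∨ y ∈ openCone U (-a :: b) :=
    fun y hy => (hcov y hy).imp_right fun h => h.resolve_right fun h' => h0 ⟨y, h'⟩
  by_cases h1 : (openCone U (a :: b)).Nonempty
  · have h2 : ¬ (openCone U (-a :: b)).Nonempty := fun h2 => h0 (openCone_inf_nonempty h1 h2)
    have heq : openCone U (a :: b) = openCone U b :=
      sub1.antisymm fun y hy => (hcov' y hy).resolve_right fun h => h2 ⟨y, h⟩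
    have hb := h1.mono sub1
    have hp : polyCone U (a :: b) = polyCone U b := by
      rw [← closure_openCone h1, ← closure_openCone hb, heq]
    simp [cellInd, h0, h1, h2, hb, projInd, hp]
  · by_cases h2 : (openCone U (-a :: b)).Nonempty
    · have heq : openCone U (-a :: b) = openCone U b :=
        sub2.antisymm fun y hy => (hcov' y hy).resolve_left fun h => h1 ⟨y, h⟩
      have hb := h2.mono sub2
      have hp : polyCone U (-a :: b) = polyCone U b := by
        rw [← closure_openCone h2, ← closure_openCone hb, heq]
      simp [cellInd, h0, h1, h2, hb, projInd, hp]
    · have hb : ¬ (openCone U b).Nonempty := by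
        rintro ⟨y, hy⟩
        rcases hcov' y hy with h | h
        · exact h1 ⟨y, h⟩
        · exact h2 ⟨y, h⟩
      simp [cellInd, h0, h1, h2, hb]

/-- All lists obtained from `l` by changing signs of entries. -/
def signings {E : Type*} [AddCommGroup E] : List E → List (List E)
  | [] => [[]]
  | a :: l => (signings l).flatMap fun b => [a :: b, -a :: b]

/-- The characteristic polynomial, computed by deletion and restriction, of the arrangement cut
out in `U` by the hyperplanes orthogonal to the members of a list. -/
noncomputable def delResPoly : List V → Submodule ℝ V → Polynomial ℤ
  | [], U => Polynomial.X ^ finrank ℝ U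
  | a :: l, U => delResPoly l U - delResPoly l (U ⊓ (ℝ ∙ a)ᗮ)

lemma sum_signings_cons {E : Type*} [AddCommGroup E] (f : List E → ℝ) (a : E) (l : List E) :
    ((signings (a :: l)).map f).sum = ((signings l).map fun b => f (a :: b) + f (-a :: b)).sum := by
  simp only [signings]
  induction signings l with
  | nil => simp
  | cons b L ih =>
    simp only [List.flatMap_cons, List.map_append, List.sum_append, List.map_cons, List.sum_cons,
      List.map_nil, List.sum_nil, ih, add_zero]

lemma projDimSet_polyCone_nil [FiniteDimensional ℝ V] (U : Submodule ℝ V) (k : ℕ) (x : V) :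
    x ∈ projDimSet (polyCone U []) k ↔ finrank ℝ U = k := by
  obtain ⟨z, hz⟩ := exists_isProjectionOnto_polyCone U [] x
  rw [hz.mem_projDimSet_iff]
  have : faceSpan U [] z = U := by ext; simp [mem_faceSpan]
  rw [this]

/-- For a measure that does not charge hyperplanes, almost every point has a number of chambers
with `k`-dimensional projection equal to the absolute value of a coefficient of the characteristic
polynomial. -/
lemma ae_sum_cellInd_eq [FiniteDimensional ℝ V] [MeasurableSpace V] (m : Measure V)
    (hm : ∀ p : V, p ≠ 0 → ∀ᵐ x ∂m, ⟪p, x⟫ ≠ 0) (l : List V) :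
    ∀ U : Submodule ℝ V, ∀ᵐ x ∂m, ∀ k : ℕ,
      ((signings l).map fun b => cellInd U b k x).sum =
        (-1) ^ (finrank ℝ U + k) * (((delResPoly l U).coeff k : ℤ) : ℝ) := by
  induction l with
  | nil =>
    intro U
    refine Eventually.of_forall fun x k => ?_
    have hne : (openCone U []).Nonempty := ⟨0, U.zero_mem, by simp⟩
    simp only [signings, List.map_cons, List.map_nil, List.sum_cons, List.sum_nil, add_zero,
      cellInd, hne, if_true, projInd, delResPoly, Polynomial.coeff_X_pow]
    by_cases h : finrank ℝ U = k
    · simp [h, ← two_mul, (projDimSet_polyCone_nil U k x).2 h]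
    · simp [Ne.symm h, mt (projDimSet_polyCone_nil U k x).1 h]
  | cons a l ih =>
    intro U
    by_cases ha : U ≤ (ℝ ∙ a)ᗮ
    -- Restriction does not change `U` here, so the two terms of `delResPoly` cancel, in agreement
    -- with two empty cells.
    · refine Eventually.of_forall fun x k => ?_
      simp [sum_signings_cons, cellInd_cons_add_cellInd_cons_of_le ha, delResPoly,
        inf_eq_left.2 ha]
    · have hgen : ∀ᵐ x ∂m, ∀ b ∈ {b | b ∈ signings l}, ∀ S ∈ Set.range (faceSpan U b),
          S.starProjection a ≠ 0 → ⟪S.starProjection a, x⟫ ≠ 0 := by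
        refine (ae_ball_iff (signings l).finite_toSet.countable).2 fun b _ => ?_
        refine (ae_ball_iff (finite_range_faceSpan b U).countable).2 fun S _ => ?_
        by_cases h0 : S.starProjection a = 0
        · simp [h0]
        · exact (hm _ h0).mono fun x hx _ => hx
      filter_upwards [ih U, ih (U ⊓ (ℝ ∙ a)ᗮ), hgen] with x h1 h2 hx k
      -- The restriction has dimension one less, so the sign `(-1) ^ (finrank + k)` turns the sum of
      -- the two counts into the difference defining `delResPoly`.
      rw [sum_signings_cons, List.map_congr_left fun b hb =>
        cellInd_cons_add_cellInd_cons ha (hx b hb) k, List.sum_map_add, h1 k, h2 k,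
        ← finrank_inf_orthogonal_singleton ha]
      simp only [delResPoly, Polynomial.coeff_sub, Int.cast_sub]
      ring

end Splitting

/-! ### Whitney's formula and the characteristic polynomial. -/

section CharPoly

variable {V : Type*} [NormedAddCommGroup V] [InnerProductSpace ℝ V]

open Classical in
lemma intersectionLattice_coe_finset (s : Finset (Submodule ℝ V)) :
    intersectionLattice (s : Set (Submodule ℝ V)) = ↑(s.powerset.image fun B => B.inf id) := by
  ext X
  simp only [intersectionLattice, Set.mem_ofPred_eq, Finset.coe_image, Set.mem_image,
    Finset.mem_coe, Finset.mem_powerset]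
  constructor
  · rintro ⟨S, hS, rfl⟩
    refine ⟨s.filter (· ∈ S), Finset.filter_subset _ _, ?_⟩
    rw [Finset.inf_id_eq_sInf]
    congr 1
    ext H
    simpa using fun h => hS h
  · rintro ⟨B, hB, rfl⟩
    exact ⟨B, by simpa using hB, Finset.inf_id_eq_sInf B⟩

open Classical in
-- The index set is the power set of the hyperplanes containing `X`. There is at least one since `X
-- ≠ ⊤`, so the alternating sum cancels.
lemma sum_powerset_filter_le_inf {s : Finset (Submodule ℝ V)} {X : Submodule ℝ V}
    (hX : X ∈ intersectionLattice (s : Set (Submodule ℝ V))) (hne : X ≠ ⊤) :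
    ∑ B ∈ s.powerset with X ≤ B.inf id, (-1 : ℤ) ^ B.card = 0 := by
  have hp : s.powerset.filter (fun B => X ≤ B.inf id) = (s.filter (X ≤ ·)).powerset := by
    ext B
    simp only [Finset.mem_filter, Finset.mem_powerset, Finset.le_inf_iff, id, Finset.subset_iff]
    exact ⟨fun h H hH => ⟨h.1 hH, h.2 H hH⟩, fun h => ⟨fun H hH => (h hH).1, fun H hH => (h hH).2⟩⟩
  rw [hp]
  apply Finset.sum_powerset_neg_one_pow_card_of_nonempty
  obtain ⟨S, hS, rfl⟩ := hX
  have : S.Nonempty := by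
    rw [Set.nonempty_iff_ne_empty]
    rintro rfl
    exact hne sInf_empty
  obtain ⟨H, hH⟩ := this
  exact ⟨H, Finset.mem_filter.2 ⟨hS hH, sInf_le hH⟩⟩

lemma orthogonal_singleton_ne_top {a : V} (ha : a ≠ 0) : (ℝ ∙ a)ᗮ ≠ ⊤ := by
  intro h
  have : a ∈ (ℝ ∙ a)ᗮ := h ▸ Submodule.mem_top
  rw [mem_orthogonal_singleton] at this
  exact ha (inner_self_eq_zero.1 this)

/-- A finite arrangement is given by a list of normal vectors, and its characteristic polynomial
satisfies the deletion-restriction recursion. -/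
lemma exists_normals_delResPoly_eq (s : Finset (Submodule ℝ V))
    (hs : ∀ H ∈ s, ∃ a : V, a ≠ 0 ∧ H = (ℝ ∙ a)ᗮ) :
    ∃ l : List V, (∀ H, H ∈ s ↔ ∃ a ∈ l, H = (ℝ ∙ a)ᗮ) ∧
      ∀ U : Submodule ℝ V, delResPoly l U =
        ∑ B ∈ s.powerset, (-1) ^ B.card * Polynomial.X ^ finrank ℝ ↥(U ⊓ B.inf id) := by
  classical
  induction s using Finset.induction_on with
  | empty => exact ⟨[], by simp, fun U => by
      rw [Finset.powerset_empty, Finset.sum_singleton, Finset.inf_empty, inf_top_eq]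
      simp [delResPoly]⟩
  | insert H s hH ih =>
    obtain ⟨l, hl, hQ⟩ := ih fun H' h' => hs H' (Finset.mem_insert_of_mem h')
    obtain ⟨a, -, rfl⟩ := hs H (Finset.mem_insert_self _ _)
    refine ⟨a :: l, fun H' => ?_, fun U => ?_⟩
    · simp [hl]
    -- Subsets without the new hyperplane give the deletion; those containing it give the
    -- restriction, with one extra sign.
    · rw [Finset.sum_powerset_insert hH, delResPoly, hQ, hQ, sub_eq_add_neg,
        ← Finset.sum_neg_distrib]
      congr 1
      refine Finset.sum_congr rfl fun B hB => ?_
      rw [Finset.card_insert_of_notMem fun h => hH (Finset.mem_powerset.1 hB h),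
        Finset.inf_insert, id, inf_assoc]
      ring

variable [FiniteDimensional ℝ V]

open Classical in
/-- Whitney's formula for the Möbius function of the intersection lattice. -/
lemma moebius_eq_sum_powerset {s : Finset (Submodule ℝ V)} (hs : ∀ H ∈ s, H ≠ ⊤)
    (X : Submodule ℝ V) (hX : X ∈ intersectionLattice (s : Set (Submodule ℝ V))) :
    moebius (s : Set (Submodule ℝ V)) X =
      ∑ B ∈ s.powerset with B.inf id = X, (-1 : ℤ) ^ B.card := by
  induction X using WellFoundedGT.induction with
  | ind X ih =>
  rw [moebius]
  split_ifs with hne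
  · subst hne
    have : s.powerset.filter (fun B => B.inf id = ⊤) = {∅} := by
      ext B
      simp only [Finset.mem_filter, Finset.mem_powerset, Finset.mem_singleton]
      constructor
      · rintro ⟨hB, h⟩
        rw [Finset.inf_eq_top_iff] at h
        exact Finset.eq_empty_of_forall_notMem fun H hH => hs H (hB hH) (h H hH)
      · rintro rfl
        simp
    rw [this, Finset.sum_singleton, Finset.card_empty, pow_zero]
  · let T := (s.powerset.image fun B => B.inf id).filter (X < ·)
    have hT : {Z | Z ∈ intersectionLattice (s : Set (Submodule ℝ V)) ∧ X < Z} = ↑T := by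
      ext Z
      rw [intersectionLattice_coe_finset]
      simp [T]
    have h1 : ∑ᶠ Z : {Z : Submodule ℝ V //
          Z ∈ intersectionLattice (s : Set (Submodule ℝ V)) ∧ X < Z}, moebius s Z.1 =
        ∑ Z ∈ T, moebius s Z := by
      rw [← finsum_mem_coe_finset, ← hT]
      exact finsum_subtype_eq_finsum_cond _
    have h2 : ∑ Z ∈ T, moebius s Z = ∑ B ∈ s.powerset with X < B.inf id, (-1 : ℤ) ^ B.card := by
      rw [← Finset.sum_fiberwise_of_maps_to (t := T) (g := fun B : Finset (Submodule ℝ V) => B.inf id)]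
      · refine Finset.sum_congr rfl fun Z hZ => ?_
        have hZ' : Z ∈ (T : Set (Submodule ℝ V)) := hZ
        rw [← hT] at hZ'
        rw [ih Z hZ'.2 hZ'.1, Finset.filter_filter]
        refine Finset.sum_congr (Finset.filter_congr fun B _ => ?_) fun _ _ => rfl
        exact ⟨fun h => ⟨h ▸ hZ'.2, h⟩, fun h => h.2⟩
      · intro B hB
        rw [Finset.mem_filter] at hB
        exact Finset.mem_filter.2 ⟨Finset.mem_image_of_mem _ hB.1, hB.2⟩
    -- Splitting `X ≤ B.inf id` into equality and strict inequality shows that the claimed sum obeys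
    -- the Möbius recursion.
    have h3 := sum_powerset_filter_le_inf hX hne
    rw [h1, h2, neg_eq_iff_add_eq_zero, ← h3, add_comm,
      ← Finset.sum_union (Finset.disjoint_filter.2 fun B _ h h' => h'.ne h.symm),
      ← Finset.filter_or]
    refine Finset.sum_congr (Finset.filter_congr fun B _ => ?_) fun _ _ => rfl
    rw [le_iff_eq_or_lt, eq_comm]

/-- Whitney's formula for the characteristic polynomial. -/
lemma charPoly_eq_sum_powerset {s : Finset (Submodule ℝ V)} (hs : ∀ H ∈ s, H ≠ ⊤) :
    charPoly (s : Set (Submodule ℝ V)) =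
      ∑ B ∈ s.powerset, (-1) ^ B.card * Polynomial.X ^ finrank ℝ ↥(B.inf id) := by
  classical
  let T := s.powerset.image fun B => B.inf id
  have h1 : charPoly (s : Set (Submodule ℝ V)) =
      ∑ X ∈ T, Polynomial.C (moebius s X) * Polynomial.X ^ finrank ℝ X := by
    rw [← finsum_mem_coe_finset, ← intersectionLattice_coe_finset]
    exact finsum_subtype_eq_finsum_cond
      (f := fun X => Polynomial.C (moebius (s : Set (Submodule ℝ V)) X) * Polynomial.X ^ finrank ℝ X) _
  rw [h1, ← Finset.sum_fiberwise_of_maps_to (t := T) (g := fun B : Finset (Submodule ℝ V) => B.inf id)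
    fun B hB => Finset.mem_image_of_mem _ hB]
  refine Finset.sum_congr rfl fun X hX => ?_
  rw [moebius_eq_sum_powerset hs X (by rw [intersectionLattice_coe_finset]; exact hX), map_sum,
    Finset.sum_mul]
  refine Finset.sum_congr rfl fun B hB => ?_
  rw [(Finset.mem_filter.1 hB).2]
  simp

lemma exists_normals {𝒜 : Set (Submodule ℝ V)} (hfin : 𝒜.Finite)
    (h𝒜 : ∀ H ∈ 𝒜, ∃ a : V, a ≠ 0 ∧ H = (ℝ ∙ a)ᗮ) :
    ∃ l : List V, (∀ H, H ∈ 𝒜 ↔ ∃ a ∈ l, H = (ℝ ∙ a)ᗮ) ∧ delResPoly l ⊤ = charPoly 𝒜 := by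
  obtain ⟨s, rfl⟩ := hfin.exists_finset_coe
  obtain ⟨l, hl, hQ⟩ := exists_normals_delResPoly_eq s h𝒜
  refine ⟨l, hl, ?_⟩
  rw [hQ, charPoly_eq_sum_powerset]
  · exact Finset.sum_congr rfl fun B _ => by rw [top_inf_eq]
  · intro H hH
    obtain ⟨a, ha, rfl⟩ := h𝒜 H hH
    exact orthogonal_singleton_ne_top ha

end CharPoly

/-! ### Chambers as sign cells, transitivity of the group, and integration of the count. -/

section Chambers

variable {V : Type*} [NormedAddCommGroup V] [InnerProductSpace ℝ V]

lemma mem_or_neg_mem_of_mem_signings {E : Type*} [AddCommGroup E] (l : List E) :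
    ∀ b ∈ signings l, (∀ v ∈ b, v ∈ l ∨ -v ∈ l) ∧ ∀ v ∈ l, v ∈ b ∨ -v ∈ b := by
  induction l with
  | nil => simp [signings]
  | cons a l ih =>
    intro b hb
    simp only [signings, List.mem_flatMap, List.mem_cons, List.not_mem_nil, or_false] at hb
    obtain ⟨b, hb, rfl | rfl⟩ := hb <;> obtain ⟨h1, h2⟩ := ih b hb <;>
      simp only [List.mem_cons, forall_eq_or_imp] <;> grind

lemma exists_mem_signings (l : List V) {x : V} (hx : ∀ a ∈ l, ⟪a, x⟫ ≠ 0) :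
    ∃ b ∈ signings l, x ∈ openCone ⊤ b := by
  induction l with
  | nil => exact ⟨[], by simp [signings], by simp [openCone]⟩
  | cons a l ih =>
    obtain ⟨b, hb, hxb⟩ := ih fun a' h => hx a' (List.mem_cons_of_mem _ h)
    have h0 := hx a List.mem_cons_self
    rcases h0.lt_or_gt with h | h
    · refine ⟨-a :: b, by simp only [signings, List.mem_flatMap]; exact ⟨b, hb, by simp⟩, ?_⟩
      rw [openCone_cons]
      exact ⟨hxb, by simpa using h⟩
    · refine ⟨a :: b, by simp only [signings, List.mem_flatMap]; exact ⟨b, hb, by simp⟩, ?_⟩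
      rw [openCone_cons]
      exact ⟨hxb, h⟩

lemma mem_arrangementCompl_iff {𝒜 : Set (Submodule ℝ V)} {l : List V}
    (hl : ∀ H, H ∈ 𝒜 ↔ ∃ a ∈ l, H = (ℝ ∙ a)ᗮ) {x : V} :
    x ∈ arrangementCompl 𝒜 ↔ ∀ a ∈ l, ⟪a, x⟫ ≠ 0 := by
  constructor
  · intro h a ha h0
    exact h _ ((hl _).2 ⟨a, ha, rfl⟩) (mem_orthogonal_singleton.2 h0)
  · rintro h H hH hx
    obtain ⟨a, ha, rfl⟩ := (hl H).1 hH
    exact h a ha (mem_orthogonal_singleton.1 hx)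

lemma openCone_subset_arrangementCompl {𝒜 : Set (Submodule ℝ V)} {l b : List V}
    (hl : ∀ H, H ∈ 𝒜 ↔ ∃ a ∈ l, H = (ℝ ∙ a)ᗮ) (hb : b ∈ signings l) :
    openCone ⊤ b ⊆ arrangementCompl 𝒜 := by
  intro x hx
  rw [mem_arrangementCompl_iff hl]
  intro a ha
  rcases (mem_or_neg_mem_of_mem_signings l b hb).2 a ha with h | h
  · exact (hx.2 a h).ne'
  · have := hx.2 _ h
    rw [inner_neg_left] at this
    linarith

/-- The cell is convex, hence connected; conversely, by the intermediate value theorem no normal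
changes sign on a connected set avoiding the hyperplanes. -/
lemma connectedComponentIn_arrangementCompl {𝒜 : Set (Submodule ℝ V)} {l b : List V}
    (hl : ∀ H, H ∈ 𝒜 ↔ ∃ a ∈ l, H = (ℝ ∙ a)ᗮ) (hb : b ∈ signings l) {x : V}
    (hx : x ∈ openCone ⊤ b) : connectedComponentIn (arrangementCompl 𝒜) x = openCone ⊤ b := by
  have hsub := openCone_subset_arrangementCompl hl hb
  refine Set.Subset.antisymm (fun y hy => ⟨trivial, fun v hv => ?_⟩)
    ((convex_openCone ⊤ b).isPreconnected.subset_connectedComponentIn hx hsub)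
  by_contra hcon
  obtain ⟨z, hz, hz0⟩ := isPreconnected_connectedComponentIn.intermediate_value hy
    (mem_connectedComponentIn (hsub hx)) (f := fun y => ⟪v, y⟫) (by fun_prop)
    ⟨not_lt.1 hcon, (hx.2 v hv).le⟩
  have hzc := (mem_arrangementCompl_iff hl).1 (connectedComponentIn_subset _ _ hz)
  rcases (mem_or_neg_mem_of_mem_signings l b hb).1 v hv with h | h
  · exact hzc v h hz0
  · exact hzc _ h (by simpa using hz0)

lemma IsFundamentalChamber.exists_polyCone [FiniteDimensional ℝ V]
    {W : Subgroup (V ≃ₗᵢ[ℝ] V)} {l : List V}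
    (hl : ∀ H, H ∈ reflectionArrangement W ↔ ∃ a ∈ l, H = (ℝ ∙ a)ᗮ) {C : Set V}
    (hC : IsFundamentalChamber W C) : ∃ b ∈ signings l, C = polyCone ⊤ b := by
  obtain ⟨x, hx, rfl⟩ := hC
  obtain ⟨b, hb, hxb⟩ := exists_mem_signings l ((mem_arrangementCompl_iff hl).1 hx)
  refine ⟨b, hb, ?_⟩
  rw [connectedComponentIn_arrangementCompl hl hb hxb, closure_openCone ⟨x, hxb⟩]

lemma isFundamentalChamber_polyCone [FiniteDimensional ℝ V]
    {W : Subgroup (V ≃ₗᵢ[ℝ] V)} {l b : List V}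
    (hl : ∀ H, H ∈ reflectionArrangement W ↔ ∃ a ∈ l, H = (ℝ ∙ a)ᗮ) (hb : b ∈ signings l)
    (hne : (openCone (⊤ : Submodule ℝ V) b).Nonempty) :
    IsFundamentalChamber W (polyCone ⊤ b) := by
  obtain ⟨x, hx⟩ := hne
  refine ⟨x, openCone_subset_arrangementCompl hl hb hx, ?_⟩
  rw [connectedComponentIn_arrangementCompl hl hb hx, closure_openCone ⟨x, hx⟩]

lemma reflection_orthogonal_singleton_apply (a x : V) :
    (ℝ ∙ a)ᗮ.reflection x = x - (2 * (⟪a, x⟫ / ‖a‖ ^ 2)) • a := by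
  rw [Submodule.reflection_orthogonal_apply, Submodule.reflection_singleton_apply]
  simp [mul_smul, two_smul]

lemma reflection_mem_of_mem_reflectionArrangement {W : Subgroup (V ≃ₗᵢ[ℝ] V)} {v : V}
    (h : (ℝ ∙ v)ᗮ ∈ reflectionArrangement W) : (ℝ ∙ v)ᗮ.reflection ∈ W := by
  obtain ⟨a, -, hH, hr⟩ := h
  have key : (ℝ ∙ v)ᗮ.reflection = (ℝ ∙ a)ᗮ.reflection := by congr 1
  rwa [key]

/-- A mirror is the fixed space of its reflection, so there are at most as many mirrors as group
elements. -/
lemma finite_reflectionArrangement (W : Subgroup (V ≃ₗᵢ[ℝ] V)) [Finite W] :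
    (reflectionArrangement W).Finite := by
  refine (Set.finite_range fun w : W =>
    LinearMap.eqLocus w.1.toLinearEquiv.toLinearMap LinearMap.id).subset ?_
  rintro H ⟨a, -, rfl, hr⟩
  refine ⟨⟨_, hr⟩, ?_⟩
  ext x
  exact Submodule.reflection_eq_self_iff x

/-- The group permutes its mirrors: conjugating the reflection in `aᗮ` by `w⁻¹` gives the reflection
in `(w⁻¹ a)ᗮ`. -/
lemma apply_mem_arrangementCompl {W : Subgroup (V ≃ₗᵢ[ℝ] V)} {w : V ≃ₗᵢ[ℝ] V} (hw : w ∈ W) {x : V}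
    (hx : x ∈ arrangementCompl (reflectionArrangement W)) :
    w x ∈ arrangementCompl (reflectionArrangement W) := by
  rintro H ⟨a, ha, rfl, hr⟩ hmem
  have hinner : ∀ y, ⟪w⁻¹ a, y⟫ = ⟪a, w y⟫ := fun y => by
    rw [← w.inner_map_map]
    congr 1
    exact w.apply_symm_apply a
  refine hx (ℝ ∙ (w⁻¹ a))ᗮ ⟨w⁻¹ a, by simpa using ha, rfl, ?_⟩ ?_
  · have : (ℝ ∙ (w⁻¹ a))ᗮ.reflection = w⁻¹ * (ℝ ∙ a)ᗮ.reflection * w := by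
      ext y
      change _ = w⁻¹ ((ℝ ∙ a)ᗮ.reflection (w y))
      rw [reflection_orthogonal_singleton_apply, reflection_orthogonal_singleton_apply, hinner,
        map_sub, map_smul, LinearIsometryEquiv.norm_map]
      congr 1
      exact (w.symm_apply_apply y).symm
    rw [this]
    exact W.mul_mem (W.mul_mem (W.inv_mem hw) hr) hw
  · rw [mem_orthogonal_singleton, hinner]
    exact mem_orthogonal_singleton.1 hmem

lemma image_arrangementCompl {W : Subgroup (V ≃ₗᵢ[ℝ] V)} {w : V ≃ₗᵢ[ℝ] V} (hw : w ∈ W) :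
    w '' arrangementCompl (reflectionArrangement W) =
      arrangementCompl (reflectionArrangement W) := by
  apply Set.Subset.antisymm
  · rintro _ ⟨x, hx, rfl⟩
    exact apply_mem_arrangementCompl hw hx
  · intro x hx
    exact ⟨w⁻¹ x, apply_mem_arrangementCompl (W.inv_mem hw) hx, w.apply_symm_apply x⟩

lemma dist_reflection_lt {v u y : V} (hu : ⟪v, u⟫ < 0) (hy : 0 < ⟪v, y⟫) :
    dist ((ℝ ∙ v)ᗮ.reflection u) y < dist u y := by
  have hv : 0 < ‖v‖ ^ 2 := by
    have : v ≠ 0 := by rintro rfl; simp at hy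
    positivity
  have h1 : ⟪(ℝ ∙ v)ᗮ.reflection u, y⟫ = ⟪u, y⟫ - 2 * (⟪v, u⟫ / ‖v‖ ^ 2) * ⟪v, y⟫ := by
    rw [reflection_orthogonal_singleton_apply, inner_sub_left, real_inner_smul_left]
  have h2 : ⟪v, u⟫ / ‖v‖ ^ 2 * ⟪v, y⟫ < 0 := mul_neg_of_neg_of_pos (div_neg_of_neg_of_pos hu hv) hy
  rw [dist_eq_norm, dist_eq_norm]
  refine lt_of_pow_lt_pow_left₀ 2 (norm_nonneg _) ?_
  rw [norm_sub_sq_real, norm_sub_sq_real, LinearIsometryEquiv.norm_map, h1]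
  linarith

/-- A finite group of isometries permutes the chambers of its reflection arrangement
transitively. -/
lemma IsFundamentalChamber.exists_image_eq [FiniteDimensional ℝ V]
    {W : Subgroup (V ≃ₗᵢ[ℝ] V)} [Finite W] {l : List V}
    (hl : ∀ H, H ∈ reflectionArrangement W ↔ ∃ a ∈ l, H = (ℝ ∙ a)ᗮ) {C D : Set V}
    (hC : IsFundamentalChamber W C) (hD : IsFundamentalChamber W D) :
    ∃ w : V ≃ₗᵢ[ℝ] V, w '' C = D := by
  obtain ⟨x, hx, rfl⟩ := hC
  obtain ⟨y, hy, rfl⟩ := hD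
  -- Take the point of the orbit of `x` nearest to `y`. A mirror separating it from `y` would
  -- reflect it to a strictly nearer orbit point, so both lie in the same cell.
  obtain ⟨⟨w, hw⟩, hmin⟩ := Finite.exists_min fun w : W => dist (w.1 x) y
  obtain ⟨b, hb, hyb⟩ := exists_mem_signings l ((mem_arrangementCompl_iff hl).1 hy)
  have hwx := apply_mem_arrangementCompl hw hx
  have hwb : w x ∈ openCone ⊤ b := by
    refine ⟨trivial, fun v hv => ?_⟩
    have hvA : (ℝ ∙ v)ᗮ ∈ reflectionArrangement W := by
      rcases (mem_or_neg_mem_of_mem_signings l b hb).1 v hv with h | h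
      · exact (hl _).2 ⟨v, h, rfl⟩
      · exact (hl _).2 ⟨-v, h, (orthogonal_singleton_neg v).symm⟩
    by_contra hcon
    have hne : ⟪v, w x⟫ ≠ 0 := fun h => hwx _ hvA (mem_orthogonal_singleton.2 h)
    have hlt := dist_reflection_lt (lt_of_le_of_ne (not_lt.1 hcon) hne) (hyb.2 v hv)
    exact hlt.not_ge
      (hmin ⟨_, W.mul_mem (reflection_mem_of_mem_reflectionArrangement hvA) hw⟩)
  refine ⟨w, ?_⟩
  have h1 := w.toHomeomorph.image_closure
    (connectedComponentIn (arrangementCompl (reflectionArrangement W)) x)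
  have h2 := w.toHomeomorph.image_connectedComponentIn hx
  simp only [LinearIsometryEquiv.coe_toHomeomorph] at h1 h2
  rw [h1, h2, image_arrangementCompl hw, connectedComponentIn_arrangementCompl hl hb hwb,
    connectedComponentIn_arrangementCompl hl hb hyb]

lemma image_polyCone (w : V ≃ₗᵢ[ℝ] V) (b : List V) :
    w '' polyCone ⊤ b = polyCone ⊤ (b.map w) := by
  ext y
  constructor
  · rintro ⟨x, hx, rfl⟩
    exact ⟨trivial, by simpa using hx.2⟩
  · rintro ⟨-, hy⟩
    refine ⟨w.symm y, ⟨trivial, fun v hv => ?_⟩, w.apply_symm_apply y⟩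
    have := hy (w v) (List.mem_map_of_mem hv)
    rwa [← w.inner_map_map, w.apply_symm_apply]

lemma faceSpan_map (w : V ≃ₗᵢ[ℝ] V) (b : List V) (z : V) :
    faceSpan ⊤ (b.map w) (w z) = (faceSpan ⊤ b z).map w.toLinearEquiv.toLinearMap := by
  ext y
  obtain ⟨y, rfl⟩ := w.surjective y
  simp only [mem_faceSpan, Submodule.mem_map, Submodule.mem_top, true_and, List.mem_map,
    forall_exists_index, and_imp, forall_apply_eq_imp_iff₂, w.inner_map_map]
  exact ⟨fun h => ⟨y, h, rfl⟩, fun ⟨y', h, he⟩ => w.injective he ▸ h⟩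

lemma measurableSet_finrank_faceSpan [MeasurableSpace V] [BorelSpace V] (b : List V)
    (k : ℕ) :
    ∀ U : Submodule ℝ V, MeasurableSet {z | finrank ℝ (faceSpan U b z) = k} := by
  induction b with
  | nil =>
    intro U
    have : ∀ z, faceSpan U [] z = U := fun z => by ext; simp [mem_faceSpan]
    have h : {z : V | finrank ℝ (faceSpan U [] z) = k} = {_z : V | finrank ℝ U = k} := by
      ext z
      exact iff_of_eq (by rw [Set.mem_ofPred_eq, Set.mem_ofPred_eq, this])
    rw [h]
    exact MeasurableSet.const _
  | cons a b ih =>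
    intro U
    have h0 : MeasurableSet {z : V | ⟪a, z⟫ = 0} :=
      (isClosed_eq (by fun_prop) continuous_const).measurableSet
    have : {z | finrank ℝ (faceSpan U (a :: b) z) = k} =
        {z : V | ⟪a, z⟫ = 0} ∩ {z | finrank ℝ (faceSpan (U ⊓ (ℝ ∙ a)ᗮ) b z) = k} ∪
        {z : V | ⟪a, z⟫ = 0}ᶜ ∩ {z | finrank ℝ (faceSpan U b z) = k} := by
      ext z
      by_cases h : ⟪a, z⟫ = 0
      · have := faceSpan_cons_of_eq (U := U) (b := b) h
        simp only [Set.mem_ofPred_eq, Set.mem_union, Set.mem_inter_iff, Set.mem_compl_iff, h]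
        rw [this]
        simp
      · have := faceSpan_cons_of_ne (U := U) (b := b) h
        simp only [Set.mem_ofPred_eq, Set.mem_union, Set.mem_inter_iff, Set.mem_compl_iff, h]
        rw [this]
        simp
    rw [this]
    exact (h0.inter (ih _)).union (h0.compl.inter (ih _))

variable [FiniteDimensional ℝ V]

lemma apply_mem_projDimSet_image_iff (w : V ≃ₗᵢ[ℝ] V) (b : List V) (k : ℕ) (x : V) :
    w x ∈ projDimSet (w '' polyCone ⊤ b) k ↔ x ∈ projDimSet (polyCone ⊤ b) k := by
  obtain ⟨z, hz⟩ := exists_isProjectionOnto_polyCone ⊤ b x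
  have hwz : IsProjectionOnto (polyCone ⊤ (b.map w)) (w x) (w z) := by
    rw [← image_polyCone]
    refine ⟨⟨z, hz.1, rfl⟩, ?_⟩
    rintro _ ⟨y, hy, rfl⟩
    rw [w.dist_map, w.dist_map]
    exact hz.2 y hy
  rw [image_polyCone, hwz.mem_projDimSet_iff, hz.mem_projDimSet_iff, faceSpan_map,
    LinearEquiv.finrank_map_eq]

variable [MeasurableSpace V] [BorelSpace V]

lemma measurableSet_projDimSet (U : Submodule ℝ V) (b : List V) (k : ℕ) :
    MeasurableSet (projDimSet (polyCone U b) k) := by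
  choose g hg using exists_isProjectionOnto_polyCone U b
  have hcont : Continuous g := LipschitzWith.continuous (K := 1) <|
    LipschitzWith.of_dist_le_mul fun x y => by
      simpa using (hg x).dist_le (convex_polyCone U b) (hg y)
  have : projDimSet (polyCone U b) k = g ⁻¹' {z | finrank ℝ (faceSpan U b z) = k} := by
    ext x
    exact (hg x).mem_projDimSet_iff
  rw [this]
  exact hcont.measurable (measurableSet_finrank_faceSpan b k U)

lemma integral_list_sum_map {α ι : Type*} [MeasurableSpace α] (m : Measure α) (f : ι → α → ℝ)
    (hf : ∀ i, Integrable (f i) m) (L : List ι) :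
    Integrable (fun x => (L.map fun i => f i x).sum) m ∧
      ∫ x, (L.map fun i => f i x).sum ∂m = (L.map fun i => ∫ x, f i x ∂m).sum := by
  induction L with
  | nil => simp
  | cons i L ih =>
    simp only [List.map_cons, List.sum_cons]
    exact ⟨(hf i).add ih.1, by rw [integral_add (hf i) ih.1, ih.2]⟩

open Classical in
/-- The number of chambers, times the measure of the set of the points with `k`-dimensional
projection onto a given chamber, is the absolute value of a coefficient of the characteristic
polynomial, times the total mass. -/
lemma card_mul_measureReal_projDimSet {W : Subgroup (V ≃ₗᵢ[ℝ] V)} [Finite W] {l : List V}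
    (hl : ∀ H, H ∈ reflectionArrangement W ↔ ∃ a ∈ l, H = (ℝ ∙ a)ᗮ)
    (hχ : delResPoly l ⊤ = charPoly (reflectionArrangement W))
    (m : Measure V) [IsFiniteMeasure m] (hm : ∀ p : V, p ≠ 0 → ∀ᵐ x ∂m, ⟪p, x⟫ ≠ 0)
    (hinv : ∀ w : V ≃ₗᵢ[ℝ] V, m.map w = m) {C : Set V} (hC : IsFundamentalChamber W C) (k : ℕ) :
    ((signings l).countP fun b => (openCone (⊤ : Submodule ℝ V) b).Nonempty) *
      m.real (projDimSet C k) =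
    |(((charPoly (reflectionArrangement W)).coeff k : ℤ) : ℝ)| * m.real Set.univ := by
  have hint : ∀ b : List V, Integrable (cellInd ⊤ b k) m ∧ ∫ x, cellInd ⊤ b k x ∂m =
      if (openCone (⊤ : Submodule ℝ V) b).Nonempty then m.real (projDimSet (polyCone ⊤ b) k)
      else 0 := by
    intro b
    by_cases h : (openCone (⊤ : Submodule ℝ V) b).Nonempty
    · have : cellInd ⊤ b k = (projDimSet (polyCone ⊤ b) k).indicator 1 := by
        ext x; simp [cellInd, h, projInd]
      rw [this, integral_indicator_one (measurableSet_projDimSet _ _ _), if_pos h]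
      exact ⟨(integrable_const (1 : ℝ)).indicator (measurableSet_projDimSet _ _ _), rfl⟩
    · have : cellInd ⊤ b k = fun _ => 0 := by
        ext x; simp [cellInd, h]
      simp [this, h]
  have hcell : ∀ b ∈ signings l, ∫ x, cellInd ⊤ b k x ∂m =
      if (openCone (⊤ : Submodule ℝ V) b).Nonempty then m.real (projDimSet C k) else 0 := by
    intro b hb
    rw [(hint b).2]
    refine if_ctx_congr Iff.rfl (fun h => ?_) fun _ => rfl
    -- An isometry carries this chamber to `C`, and `m` is invariant, so all chambers contribute
    -- equally.
    obtain ⟨w, hw⟩ := (isFundamentalChamber_polyCone hl hb h).exists_image_eq hl hC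
    have hpre : w ⁻¹' projDimSet C k = projDimSet (polyCone ⊤ b) k := by
      ext x
      rw [← hw]
      exact apply_mem_projDimSet_image_iff w b k x
    rw [← hpre, measureReal_def, measureReal_def]
    conv_rhs => rw [← hinv w]
    exact congrArg _ (w.toHomeomorph.toMeasurableEquiv.map_apply _).symm
  have hsum := (integral_list_sum_map m _ (fun b => (hint b).1) (signings l)).2
  rw [List.map_congr_left hcell, integral_congr_ae
    ((ae_sum_cellInd_eq m hm l ⊤).mono fun x hx => hx k), integral_const, hχ, smul_eq_mul] at hsum
  have hcount : ((signings l).map fun b => if (openCone (⊤ : Submodule ℝ V) b).Nonempty then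
        m.real (projDimSet C k) else 0).sum =
      ((signings l).countP fun b => (openCone (⊤ : Submodule ℝ V) b).Nonempty) *
        m.real (projDimSet C k) := by
    induction signings l with
    | nil => simp
    | cons b L ih =>
      rw [List.map_cons, List.sum_cons, ih, List.countP_cons]
      by_cases h : (openCone (⊤ : Submodule ℝ V) b).Nonempty
      · simp only [h, decide_true, if_true]
        push_cast
        ring
      · simp [h]
  rw [hcount] at hsum
  rw [← hsum]
  -- The signed coefficient times the total mass equals a nonnegative quantity, so passing to
  -- absolute values removes the sign.
  have hnn : 0 ≤ m.real Set.univ * ((-1) ^ (finrank ℝ (⊤ : Submodule ℝ V) + k) *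
      (((charPoly (reflectionArrangement W)).coeff k : ℤ) : ℝ)) := by
    rw [hsum]; positivity
  rw [← abs_of_nonneg hnn, abs_mul, abs_mul, abs_pow, abs_neg, abs_one, one_pow, one_mul,
    abs_of_nonneg measureReal_nonneg, mul_comm]

end Chambers

/-! ### The Gaussian and surface measures: null hyperplanes and invariance. -/

section Measures

variable {V : Type*} [NormedAddCommGroup V] [InnerProductSpace ℝ V] [FiniteDimensional ℝ V]
  [MeasurableSpace V] [BorelSpace V]

/-- The image under `⟪p, ·⟫` is a real Gaussian of variance `‖p‖ ^ 2 ≠ 0`, which has no atoms. -/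
lemma ae_stdGaussian_inner_ne_zero {p : V} (hp : p ≠ 0) :
    ∀ᵐ x ∂ProbabilityTheory.stdGaussian V, ⟪p, x⟫ ≠ 0 := by
  have hmap := ProbabilityTheory.IsGaussian.map_eq_gaussianReal
    (μ := ProbabilityTheory.stdGaussian V) (innerSL ℝ p)
  rw [ProbabilityTheory.variance_dual_stdGaussian] at hmap
  have hv : (‖innerSL ℝ p‖ ^ 2).toNNReal ≠ 0 := by
    rw [innerSL_apply_norm]
    simpa using hp
  have := ProbabilityTheory.nullSingletonClass_gaussianReal
    (μ := ∫ x, innerSL ℝ p x ∂(ProbabilityTheory.stdGaussian V)) hv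
  have h0 : (ProbabilityTheory.stdGaussian V).map (innerSL ℝ p) {0} = 0 := by
    rw [hmap]
    exact measure_singleton 0
  rw [Measure.map_apply (by fun_prop) (measurableSet_singleton 0)] at h0
  exact measure_eq_zero_iff_ae_notMem.1 h0

/-- The surface measure of the unit sphere, as a measure on the ambient space. -/
noncomputable def sphereMeasure (V : Type*) [NormedAddCommGroup V] [InnerProductSpace ℝ V]
    [FiniteDimensional ℝ V] [MeasurableSpace V] [BorelSpace V] : Measure V :=
  (volume : Measure V).toSphere.map Subtype.val

instance : IsFiniteMeasure (sphereMeasure V) := by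
  unfold sphereMeasure; infer_instance

/-- Surface measure is read off from the volume of the truncated cone over `s`, which reduces null
sets and invariance to those of Lebesgue measure. -/
lemma sphereMeasure_apply {s : Set V} (hs : MeasurableSet s) :
    sphereMeasure V s = finrank ℝ V * volume
      {x : V | ∃ r ∈ Set.Ioo (0 : ℝ) 1, ∃ u ∈ s, ‖u‖ = 1 ∧ r • u = x} := by
  rw [sphereMeasure, Measure.map_apply measurable_subtype_coe hs,
    Measure.toSphere_apply' _ (measurable_subtype_coe hs)]
  congr 2
  ext x
  simp [Set.mem_smul, and_assoc, and_left_comm]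

lemma ae_sphereMeasure_inner_ne_zero {p : V} (hp : p ≠ 0) :
    ∀ᵐ x ∂sphereMeasure V, ⟪p, x⟫ ≠ 0 := by
  rw [ae_iff]
  simp only [not_not]
  rw [sphereMeasure_apply (isClosed_eq (by fun_prop) continuous_const).measurableSet]
  have h0 := Measure.addHaar_submodule (volume : Measure V) _ (orthogonal_singleton_ne_top hp)
  rw [measure_mono_null _ h0, mul_zero]
  rintro _ ⟨r, -, u, hu, -, rfl⟩
  exact mem_orthogonal_singleton.2 (by rw [real_inner_smul_right, hu, mul_zero])

lemma sphereMeasure_map (w : V ≃ₗᵢ[ℝ] V) : (sphereMeasure V).map w = sphereMeasure V := by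
  ext s hs
  have hw : Measurable w := w.continuous.measurable
  rw [Measure.map_apply hw hs, sphereMeasure_apply (hw hs), sphereMeasure_apply hs]
  congr 1
  refine Eq.trans ?_
    (w.measurePreserving.measure_preimage_emb w.toHomeomorph.measurableEmbedding _)
  congr 1
  ext x
  constructor
  · rintro ⟨r, hr, u, hu, h1, rfl⟩
    exact ⟨r, hr, w u, hu, by rw [w.norm_map, h1], (map_smul w r u).symm⟩
  · rintro ⟨r, hr, u, hu, h1, h2⟩
    refine ⟨r, hr, w.symm u, by simpa using hu, by rw [w.symm.norm_map, h1], w.injective ?_⟩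
    rw [map_smul, w.apply_symm_apply, h2]

lemma projVolume_polyCone (U : Submodule ℝ V) (b : List V) (k : ℕ) :
    projVolume (polyCone U b) k =
      (sphereMeasure V).real (projDimSet (polyCone U b) k) / (sphereMeasure V).real Set.univ := by
  simp only [projVolume, sphereMeasure, measureReal_def]
  rw [Measure.map_apply measurable_subtype_coe (measurableSet_projDimSet U b k),
    Measure.map_apply measurable_subtype_coe MeasurableSet.univ]
  rfl

lemma sphereMeasure_real_univ_pos [Nontrivial V] : 0 < (sphereMeasure V).real Set.univ := by
  rw [measureReal_def, sphereMeasure, Measure.map_apply measurable_subtype_coe MeasurableSet.univ,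
    Set.preimage_univ]
  exact ENNReal.toReal_pos (mt Measure.measure_univ_eq_zero.1 (Measure.toSphere_ne_zero volume))
    (measure_ne_top _ _)

end Measures

/-! ### Nontriviality of the ambient space for types A, B and D. -/

section Types

lemma nontrivial_of_isReflectionGroupOf {E V : Type*} [NormedAddCommGroup E]
    [InnerProductSpace ℝ E] [NormedAddCommGroup V] [InnerProductSpace ℝ V] {Φ : Set E} {a : E}
    (ha : a ∈ Φ) (h0 : a ≠ 0) {W : Subgroup (V ≃ₗᵢ[ℝ] V)} (hW : IsReflectionGroupOf Φ W) :
    Nontrivial V := by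
  obtain ⟨f, -⟩ := hW
  refine ⟨f ⟨a, Submodule.subset_span ha⟩, 0, fun h => h0 ?_⟩
  have := f.injective (h.trans f.map_zero.symm)
  exact congrArg Subtype.val this

lemma single_sub_single_ne_zero {ι : Type*} [Fintype ι] [DecidableEq ι] {i j : ι} (hij : i ≠ j) :
    EuclideanSpace.single i (1 : ℝ) - EuclideanSpace.single j (1 : ℝ) ≠ 0 := by
  intro h
  have := congrArg (fun v : EuclideanSpace ℝ ι => v i) h
  simp [hij] at this

/-- Each bound on `n` provides a nonzero root. The space is then nonzero, so its unit sphere has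
positive measure and the quotient in `projVolume` is meaningful. -/
lemma IsTypeABD.nontrivial {V : Type*} [NormedAddCommGroup V] [InnerProductSpace ℝ V] {n : ℕ}
    {W : Subgroup (V ≃ₗᵢ[ℝ] V)} (hW : IsTypeABD n W) : Nontrivial V := by
  rcases hW with ⟨hn, h⟩ | ⟨hn, h⟩ | ⟨hn, h⟩
  · have hij : (⟨0, by omega⟩ : Fin (n + 1)) ≠ ⟨1, by omega⟩ := by simp
    exact nontrivial_of_isReflectionGroupOf (Φ := rootsA n) ⟨_, _, hij, rfl⟩
      (single_sub_single_ne_zero hij) h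
  · exact nontrivial_of_isReflectionGroupOf (Φ := rootsB n)
      (a := EuclideanSpace.single ⟨0, by omega⟩ 1) (Or.inl ⟨_, Or.inl rfl⟩) (by simp) h
  · have hij : (⟨0, by omega⟩ : Fin n) ≠ ⟨1, by omega⟩ := by simp
    exact nontrivial_of_isReflectionGroupOf (Φ := rootsD n) ⟨_, _, hij, Or.inl rfl⟩
      (single_sub_single_ne_zero hij) h

end Types

end ReflArr

theorem corollary1p3 (d n : ℕ)
    (W : Subgroup (EuclideanSpace ℝ (Fin d) ≃ₗᵢ[ℝ] EuclideanSpace ℝ (Fin d))) [Finite W]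
    (hW : ReflArr.IsTypeABD n W) :
    (∃ c : ℝ, 0 < c ∧ ∀ C : Set (EuclideanSpace ℝ (Fin d)), ReflArr.IsFundamentalChamber W C →
      ∀ k : ℕ, ReflArr.projVolume C k =
        c * |(((ReflArr.charPoly (ReflArr.reflectionArrangement W)).coeff k : ℤ) : ℝ)|) ∧
    (∀ C : Set (EuclideanSpace ℝ (Fin d)), ReflArr.IsFundamentalChamber W C →
      ∀ k : ℕ, (ProbabilityTheory.stdGaussian (EuclideanSpace ℝ (Fin d))).real
        (ReflArr.projDimSet C k) = ReflArr.projVolume C k) := by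
  classical
  have := hW.nontrivial
  have hhyp : ∀ H ∈ ReflArr.reflectionArrangement W,
      ∃ a : EuclideanSpace ℝ (Fin d), a ≠ 0 ∧ H = (Submodule.span ℝ {a})ᗮ :=
    fun H ⟨a, ha, h, _⟩ => ⟨a, ha, h⟩
  obtain ⟨l, hl, hχ⟩ := ReflArr.exists_normals (ReflArr.finite_reflectionArrangement W) hhyp
  -- `N` counts the chambers. It is positive because a Gaussian point almost surely avoids all
  -- mirrors and so lies in some open cell.
  set N := (ReflArr.signings l).countP fun b =>
    (ReflArr.openCone (⊤ : Submodule ℝ (EuclideanSpace ℝ (Fin d))) b).Nonempty with hN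
  have hNpos : (0 : ℝ) < N := by
    have hne : ∀ a ∈ {a | a ∈ l}, a ≠ 0 := by
      rintro _ ha rfl
      obtain ⟨a, ha', h⟩ := hhyp _ ((hl _).2 ⟨0, ha, rfl⟩)
      exact ReflArr.orthogonal_singleton_ne_top ha' (by simp [← h])
    obtain ⟨x, hx⟩ := ((MeasureTheory.ae_ball_iff l.finite_toSet.countable).2 fun a ha =>
      ReflArr.ae_stdGaussian_inner_ne_zero (hne a ha)).exists
    obtain ⟨b, hb, hxb⟩ := ReflArr.exists_mem_signings l hx
    exact_mod_cast List.countP_pos_iff.2 ⟨b, hb, by simpa using ⟨x, hxb⟩⟩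
  have hS : ∀ C, ReflArr.IsFundamentalChamber W C → ∀ k, ReflArr.projVolume C k =
      (N : ℝ)⁻¹ * |(((ReflArr.charPoly (ReflArr.reflectionArrangement W)).coeff k : ℤ) : ℝ)| := by
    intro C hC k
    have key := ReflArr.card_mul_measureReal_projDimSet hl hχ (ReflArr.sphereMeasure _)
      (fun p hp => ReflArr.ae_sphereMeasure_inner_ne_zero hp) ReflArr.sphereMeasure_map hC k
    have hpos := ReflArr.sphereMeasure_real_univ_pos (V := EuclideanSpace ℝ (Fin d))
    obtain ⟨b, -, rfl⟩ := hC.exists_polyCone hl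
    rw [ReflArr.projVolume_polyCone, div_eq_iff hpos.ne', mul_assoc, ← key,
      inv_mul_cancel_left₀ hNpos.ne']
  refine ⟨⟨(N : ℝ)⁻¹, inv_pos.2 hNpos, hS⟩, fun C hC k => ?_⟩
  -- The same count with total mass one gives the same value, hence equality with the projection
  -- volume.
  have key := ReflArr.card_mul_measureReal_projDimSet hl hχ (ProbabilityTheory.stdGaussian _)
    (fun p hp => ReflArr.ae_stdGaussian_inner_ne_zero hp)
    (fun w => ProbabilityTheory.stdGaussian_map w) hC k
  rw [MeasureTheory.probReal_univ, mul_one] at key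
  rw [hS C hC k, ← key, inv_mul_cancel_left₀ hNpos.ne']
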